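/- Let $R$ be a ring with identity (not necessarily commutative) and let $\mathrm{Ch}(R)$ be the category of $\mathbb{Z}$-indexed chain complexes of left $R$-modules, with differentials $d_n : X_n \to X_{n-1}$ and cycles $Z_nX=\ker d_n$. An injective cotorsion pair in $\mathrm{Ch}(R)$ is a pair $(\mathcal{W},\mathcal{F})$ of classes of complexes such that: - $\mathcal{W}=\{A : \mathrm{Ext}^1_{\mathrm{Ch}(R)}(A,B)=0 \text{ for all } B\in\mathcal{F}\}$ and $\mathcal{F}=\{B : \mathrm{Ext}^1_{\mathrm{Ch}(R)}(A,B)=0 \text{ for all } A\in\mathcal{W}\}$; - for each complex $A$ there are short exact sequences $0\to A\to Y\to X\to 0$ and $0\to Y'\to X'\to A\to 0$ with $X,X'\in\mathcal{W}$ and $Y,Y'\in\mathcal{F}$; - $\mathcal{W}$ is thick, i.e. whenever two of the three terms of a short exact sequence of complexes lie in $\mathcal{W}$, so does the third; - $\mathcal{W}\cap\mathcal{F}$ is the class of injective objects of $\mathrm{Ch}(R)$. A left $R$-module $C$ is cotorsion if $\mathrm{Ext}^1_R(F,C)=0$ for every flat left $R$-module $F$. A complex $X$ is DG-flat if each $X_n$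 is flat and $E\otimes_R X$ is exact for every exact chain complex $E$ of right $R$-modules; here $(E\otimes_R X)_n=\bigoplus_{i+j=n}E_i\otimes_R X_j$, with differential $x\otimes y\mapsto dx\otimes y+(-1)^{|x|}x\otimes dy$. Let $(\mathcal{W},\mathcal{F})$ be an injective cotorsion pair in $\mathrm{Ch}(R)$. Then: 1. For every exact complex $Y\in\mathcal{F}$ and every $n\in\mathbb{Z}$, the cycle module $Z_nY$ and the component $Y_n$ are cotorsion modules. 2. If every complex in $\mathcal{F}$ is exact, then every DG-flat complex lies in $\mathcal{W}$. -/

import Mathlib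

open CategoryTheory CategoryTheory.Limits CategoryTheory.Abelian
open scoped TensorProduct

universe u

/-! ### The tensor product over a ring that need not be commutative

A right `R`-module is a module over `Rᵐᵒᵖ`, with `a · r = MulOpposite.op r • a`. -/

namespace NCTensor

section Modules

variable (R : Type u) [Ring R]

/-- The subgroup of `A ⊗[ℤ] M` generated by the elements `(a · r) ⊗ m - a ⊗ (r • m)`. -/
def relations (A M : Type u) [AddCommGroup A] [Module Rᵐᵒᵖ A] [AddCommGroup M] [Module R M] :
    Submodule ℤ (A ⊗[ℤ] M) :=
  Submodule.span ℤ {t | ∃ (a : A) (r : R) (m : M),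
    t = (MulOpposite.op r • a) ⊗ₜ[ℤ] m - a ⊗ₜ[ℤ] (r • m)}

/-- The abelian group `A ⊗_R M`, for a right `R`-module `A` and a left `R`-module `M`. -/
abbrev Tensor (A M : Type u) [AddCommGroup A] [Module Rᵐᵒᵖ A] [AddCommGroup M] [Module R M] :
    Type u :=
  (A ⊗[ℤ] M) ⧸ relations R A M

variable {R}
variable {A B C : Type u} [AddCommGroup A] [Module Rᵐᵒᵖ A] [AddCommGroup B] [Module Rᵐᵒᵖ B]
  [AddCommGroup C] [Module Rᵐᵒᵖ C]
variable {M N P : Type u} [AddCommGroup M] [Module R M] [AddCommGroup N] [Module R N]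
  [AddCommGroup P] [Module R P]

theorem relations_le_comap (f : A →ₗ[Rᵐᵒᵖ] B) (g : M →ₗ[R] N) :
    relations R A M ≤ (relations R B N).comap
      (TensorProduct.map f.toAddMonoidHom.toIntLinearMap g.toAddMonoidHom.toIntLinearMap) := by
  refine Submodule.span_le.2 ?_
  rintro _ ⟨a, r, m, rfl⟩
  refine Submodule.subset_span ⟨f a, r, g m, ?_⟩
  simp [map_sub]

/-- The homomorphism `f ⊗ g : A ⊗_R M → B ⊗_R N`. -/
def tensorMap (f : A →ₗ[Rᵐᵒᵖ] B) (g : M →ₗ[R] N) : Tensor R A M →ₗ[ℤ] Tensor R B N :=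
  Submodule.mapQ _ _
    (TensorProduct.map f.toAddMonoidHom.toIntLinearMap g.toAddMonoidHom.toIntLinearMap)
    (relations_le_comap f g)

@[simp]
theorem tensorMap_mk_tmul (f : A →ₗ[Rᵐᵒᵖ] B) (g : M →ₗ[R] N) (a : A) (m : M) :
    tensorMap f g (Submodule.Quotient.mk (a ⊗ₜ[ℤ] m)) =
      Submodule.Quotient.mk (f a ⊗ₜ[ℤ] g m) := rfl

theorem tensor_hom_ext {G : Type u} [AddCommGroup G] {φ ψ : Tensor R A M →ₗ[ℤ] G}
    (h : ∀ a m, φ (Submodule.Quotient.mk (a ⊗ₜ[ℤ] m)) =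
      ψ (Submodule.Quotient.mk (a ⊗ₜ[ℤ] m))) : φ = ψ := by
  refine Submodule.linearMap_qext _ (TensorProduct.ext' fun a m => ?_)
  exact h a m

theorem tensorMap_id : tensorMap (LinearMap.id : A →ₗ[Rᵐᵒᵖ] A) (LinearMap.id : M →ₗ[R] M) =
    LinearMap.id :=
  tensor_hom_ext fun _ _ => rfl

theorem tensorMap_comp (f : A →ₗ[Rᵐᵒᵖ] B) (f' : B →ₗ[Rᵐᵒᵖ] C) (g : M →ₗ[R] N)
    (g' : N →ₗ[R] P) :
    tensorMap (f' ∘ₗ f) (g' ∘ₗ g) = tensorMap f' g' ∘ₗ tensorMap f g :=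
  tensor_hom_ext fun _ _ => rfl

@[simp]
theorem tensorMap_zero_left (g : M →ₗ[R] N) : tensorMap (0 : A →ₗ[Rᵐᵒᵖ] B) g = 0 :=
  tensor_hom_ext fun _ _ => by simp

@[simp]
theorem tensorMap_zero_right (f : A →ₗ[Rᵐᵒᵖ] B) : tensorMap f (0 : M →ₗ[R] N) = 0 :=
  tensor_hom_ext fun _ _ => by simp

end Modules

variable (R : Type u) [Ring R]

/-- The bifunctor `(A, M) ↦ A ⊗_R M` from right and left `R`-modules to abelian groups. -/
def tensorBifunctor : ModuleCat.{u} Rᵐᵒᵖ ⥤ ModuleCat.{u} R ⥤ ModuleCat.{u} ℤ where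
  obj A :=
    { obj := fun M => ModuleCat.of ℤ (Tensor R A M)
      map := fun g => ModuleCat.ofHom (tensorMap LinearMap.id g.hom)
      map_id := fun M => by
        ext1
        exact tensorMap_id
      map_comp := fun g g' => by
        ext1
        exact tensorMap_comp LinearMap.id LinearMap.id g.hom g'.hom }
  map f :=
    { app := fun M => ModuleCat.ofHom (tensorMap f.hom LinearMap.id)
      naturality := fun M N g => by
        ext1
        exact (tensorMap_comp LinearMap.id f.hom g.hom LinearMap.id).symm.trans
          (tensorMap_comp f.hom LinearMap.id LinearMap.id g.hom) }
  map_id A := by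
    ext M : 3
    exact tensorMap_id
  map_comp f f' := by
    ext M : 3
    exact tensorMap_comp f.hom f'.hom LinearMap.id LinearMap.id

instance : (tensorBifunctor R).PreservesZeroMorphisms where
  map_zero A B := by
    ext M : 3
    exact tensorMap_zero_left LinearMap.id

instance (A : ModuleCat.{u} Rᵐᵒᵖ) : ((tensorBifunctor R).obj A).PreservesZeroMorphisms where
  map_zero M N := by
    ext1
    exact tensorMap_zero_right LinearMap.id

end NCTensor

/-! ### Flat modules, cotorsion modules, and the tensor product of complexes -/

/-- Total indices and signs for chain complexes indexed by `ℤ`: the summand of bidegree `(i, j)`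
sits in degree `i + j`, the first differential has sign `1`, the second one `(-1) ^ i`. -/
instance tensorSignsDownInt : ComplexShape.TensorSigns (ComplexShape.down ℤ) where
  ε' := MonoidHom.mk' (fun i : ℤ => Int.negOnePow i) Int.negOnePow_add
  rel_add p q r (hpq : q + 1 = p) := show q + r + 1 = p + r by lia
  add_rel p q r (hpq : q + 1 = p) := show r + q + 1 = r + p by lia
  ε'_succ := by
    rintro _ q rfl
    exact (neg_eq_iff_eq_neg.2 (Int.negOnePow_succ q)).symm

section

variable {R : Type u} [Ring R]

/-- A left `R`-module `M` is flat if `- ⊗_R M` preserves injectivity of homomorphisms of right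
`R`-modules. -/
def IsFlatModule (M : ModuleCat.{u} R) : Prop :=
  ∀ ⦃A B : ModuleCat.{u} Rᵐᵒᵖ⦄ (f : A →ₗ[Rᵐᵒᵖ] B), Function.Injective f →
    Function.Injective (NCTensor.tensorMap f (LinearMap.id : M →ₗ[R] M))

/-- A left `R`-module `C` is cotorsion if `Ext¹_R(F, C) = 0` for every flat `F`. -/
def IsCotorsionModule (C : ModuleCat.{u} R) : Prop :=
  ∀ F : ModuleCat.{u} R, IsFlatModule F → Subsingleton (Ext F C 1)

/-- The tensor product `E ⊗_R X` of a complex `E` of right modules and a complex `X` of left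
modules: in degree `n` it is the direct sum of the `E_i ⊗_R X_j` with `i + j = n`, and its
differential is `x ⊗ y ↦ dx ⊗ y + (-1)^|x| x ⊗ dy`. -/
noncomputable def tensorComplex (E : ChainComplex (ModuleCat.{u} Rᵐᵒᵖ) ℤ)
    (X : ChainComplex (ModuleCat.{u} R) ℤ) : ChainComplex (ModuleCat.{u} ℤ) ℤ :=
  HomologicalComplex.mapBifunctor E X (NCTensor.tensorBifunctor R) (ComplexShape.down ℤ)

/-- A complex `X` is DG-flat if every `X_n` is flat and `E ⊗_R X` is exact for every exact complex
`E` of right `R`-modules. -/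
def IsDGFlat (X : ChainComplex (ModuleCat.{u} R) ℤ) : Prop :=
  (∀ n : ℤ, IsFlatModule (X.X n)) ∧
    ∀ E : ChainComplex (ModuleCat.{u} Rᵐᵒᵖ) ℤ, E.Acyclic → (tensorComplex E X).Acyclic

end

/-! ### Cotorsion pairs in a Grothendieck category -/

section

variable {G : Type*} [Category.{u} G] [Abelian G] [IsGrothendieckAbelian.{u} G]

/-- `(W, F)` is a cotorsion pair: `W = ⊥F` and `F = W⊥` with respect to `Ext¹`. -/
structure IsCotorsionPair (W F : ObjectProperty G) : Prop where
  left_iff (A : G) : W A ↔ ∀ B : G, F B → Subsingleton (Ext A B 1)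
  right_iff (B : G) : F B ↔ ∀ A : G, W A → Subsingleton (Ext A B 1)

/-- `(W, F)` has enough injectives and enough projectives: every `A` fits in short exact sequences
`0 ⟶ A ⟶ Y ⟶ X ⟶ 0` and `0 ⟶ Y' ⟶ X' ⟶ A ⟶ 0` with `X, X'` in `W` and `Y, Y'` in `F`. -/
structure IsCompletePair (W F : ObjectProperty G) : Prop where
  enough_injectives (A : G) : ∃ (Y X : G) (i : A ⟶ Y) (p : Y ⟶ X) (w : i ≫ p = 0),
    F Y ∧ W X ∧ (ShortComplex.mk i p w).ShortExact
  enough_projectives (A : G) : ∃ (Y X : G) (i : Y ⟶ X) (p : X ⟶ A) (w : i ≫ p = 0),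
    F Y ∧ W X ∧ (ShortComplex.mk i p w).ShortExact

/-- `W` has the two out of three property on short exact sequences. (The left class of a cotorsion
pair is automatically closed under direct summands.) -/
structure IsThickClass (W : ObjectProperty G) : Prop where
  left (S : ShortComplex G) (hS : S.ShortExact) : W S.X₂ → W S.X₃ → W S.X₁
  middle (S : ShortComplex G) (hS : S.ShortExact) : W S.X₁ → W S.X₃ → W S.X₂
  right (S : ShortComplex G) (hS : S.ShortExact) : W S.X₁ → W S.X₂ → W S.X₃

/-- `(W, F)` is an injective cotorsion pair: a complete cotorsion pair with `W` thick and `W ∩ F`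
the class of injective objects. -/
structure IsInjectiveCotorsionPair (W F : ObjectProperty G) : Prop where
  cotorsionPair : IsCotorsionPair W F
  complete : IsCompletePair W F
  thick : IsThickClass W
  inter_iff (A : G) : W A ∧ F A ↔ Injective A

end

/-!
Both parts follow from one vanishing statement (`IsInjectiveCotorsionPair.subsingleton_ext`): if
`X` is DG-flat, or a flat module in a single degree, then `Ext¹(X, Y) = 0` for every exact complex
`Y` in `F`. For part two, `W` is the left orthogonal of `F`. For part one, a chain map to `Y` from
a complex concentrated in degree `n` is a homomorphism to `Z_n Y`, so the vanishing for a flat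
module in degree `n` says that `Z_n Y` is cotorsion, and `Y_n` is an extension of `Z_{n-1} Y` by
`Z_n Y`.

To prove the vanishing, embed `Y` in an injective complex `I`. As `Y` and `I` are exact, so is `I
/ Y`. By the small object argument `X` maps to an exact complex `T` by a map `ι` that lifts
against all epimorphisms with exact kernel (`exists_acyclic_approximation`). A chain map from `X`
to `I / Y` therefore extends to `T`, and if `T` lies in `W` the extension lifts to `I`. It remains
to see that `T` lies in `W`, which has two steps.

The cycles of `T` are flat. Write `M⁺` for the character module `Hom_ℤ(M, ℚ/ℤ)`. Flatness of a
left module `M` is used in the form of injectivity of `M⁺` (`HasInjectiveDual`). As `X` is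
DG-flat, `X` tensored with the exact complex `T⁺` is exact; the functional `e ⊗ x ↦ ± e (ι x)` on
the tensor product then factors through the differential, so the composite `X ⟶ T ⟶ T⁺⁺` is
null-homotopic (`IsDGFlat.hasDGInjectiveDual`). For a flat module in a single degree the
null-homotopy comes from the injectivity of its character module
(`HasDGInjectiveDual.of_d_eq_zero`). The null-homotopy
extends along `ι` to `T ⟶ T⁺⁺`, by lifting along the trivial fibration from a contractible complex
to `T⁺⁺`. It shows that the character modules of the cycles are direct summands of the injective
modules `(T_i)⁺`.

Exact complexes `K` with flat cycles lie in `W`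
(`IsInjectiveCotorsionPair.mem_of_acyclic_of_flat_cycles`). Let `P` be a free contractible complex
that covers `K`, with infinitely many copies of each generator. By the equational criterion for
flatness of the cycles, finitely many elements of the kernel `L` of `P ⟶ K` are killed by an
endomorphism `e` of `P` over `K`. Let `A` be a finite part of the basis whose span contains them,
and let `τ` move the generators to copies outside `A`. Then the map `1 - τ ∘ e` embeds the span of
`A` in `L`, with the given elements in its image. Thus `L` is a directed union of projective
subcomplexes. Subobjects in the thick class `W` are closed under directed unions
(`IsInjectiveCotorsionPair.iSup_directed_mem`): a directed union is built from continuous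
well-ordered chains of subobjects in `W`, and the union of such a chain lies in `W` by Eklof's
lemma, since thickness puts the successive quotients in `W`. So `L` lies in `W`, and by thickness
so does `K`.
-/

/-! ### Orthogonality and exact sequences in a Grothendieck category -/

theorem shortExact_cokernel_ofLE {G : Type*} [Category* G] [Abelian G] {P : G}
    {A B : Subobject P} (h : A ≤ B) :
    (ShortComplex.mk (Subobject.ofLE A B h) (cokernel.π (Subobject.ofLE A B h))
      (cokernel.condition _)).ShortExact where
  exact := ShortComplex.exact_cokernel _
  mono_f := inferInstanceAs (Mono (Subobject.ofLE A B h))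
  epi_g := inferInstanceAs (Epi (cokernel.π (Subobject.ofLE A B h)))

section OrthogonalClass

variable {G : Type*} [Category.{u} G] [Abelian G] [IsGrothendieckAbelian.{u} G]

/-- If `Ext¹(X, S.X₁) = 0`, then every morphism from `X` lifts along the epimorphism of `S`. -/
theorem exists_lift_of_subsingleton_ext {S : ShortComplex G} (hS : S.ShortExact) {X : G}
    (hX : Subsingleton (Ext X S.X₁ 1)) (h : X ⟶ S.X₃) : ∃ g : X ⟶ S.X₂, g ≫ S.g = h := by
  obtain ⟨x, hx⟩ := Ext.covariant_sequence_exact₃ X hS (Ext.mk₀ h) (n₁ := 1) rfl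
    (Subsingleton.elim _ _)
  obtain ⟨g, rfl⟩ := Ext.homEquiv₀.symm.surjective x
  refine ⟨g, Ext.homEquiv₀.symm.injective ?_⟩
  simpa [Ext.homEquiv₀] using hx

theorem subsingleton_ext_of_exists_lift {S : ShortComplex G} (hS : S.ShortExact)
    [Injective S.X₂] {X : G} (hX : ∀ h : X ⟶ S.X₃, ∃ g : X ⟶ S.X₂, g ≫ S.g = h) :
    Subsingleton (Ext X S.X₁ 1) := by
  refine subsingleton_of_forall_eq 0 fun x => ?_
  obtain ⟨y, rfl⟩ := Ext.covariant_sequence_exact₁ X hS x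
    (Ext.eq_zero_of_injective _) (zero_add 1)
  obtain ⟨h, rfl⟩ := Ext.homEquiv₀.symm.surjective y
  obtain ⟨g, rfl⟩ := hX h
  have : (Ext.homEquiv₀.symm (g ≫ S.g) : Ext X S.X₃ 0) =
      (Ext.mk₀ g).comp (Ext.mk₀ S.g) (zero_add 0) := by
    simp [Ext.homEquiv₀]
  rw [this, Ext.comp_assoc_of_second_deg_zero, hS.comp_extClass, Ext.comp_zero]

/-- If `Ext¹(S.X₃, Y) = 0`, then every morphism to `Y` extends along the monomorphism of `S`. -/
theorem exists_extension_of_subsingleton_ext {S : ShortComplex G} (hS : S.ShortExact) {Y : G}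
    (hY : Subsingleton (Ext S.X₃ Y 1)) (h : S.X₁ ⟶ Y) : ∃ g : S.X₂ ⟶ Y, S.f ≫ g = h := by
  obtain ⟨x, hx⟩ := Ext.contravariant_sequence_exact₁ hS Y (Ext.mk₀ h) (n₁ := 1) rfl
    (Subsingleton.elim _ _)
  obtain ⟨g, rfl⟩ := Ext.homEquiv₀.symm.surjective x
  refine ⟨g, Ext.homEquiv₀.symm.injective ?_⟩
  simpa [Ext.homEquiv₀] using hx

theorem subsingleton_ext_of_shortExact_right {S : ShortComplex G} (hS : S.ShortExact) {X : G}
    (h₁ : Subsingleton (Ext X S.X₁ 1)) (h₃ : Subsingleton (Ext X S.X₃ 1)) :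
    Subsingleton (Ext X S.X₂ 1) := by
  refine subsingleton_of_forall_eq 0 fun x => ?_
  obtain ⟨y, rfl⟩ := Ext.covariant_sequence_exact₂ X hS x (Subsingleton.elim _ _)
  rw [Subsingleton.elim y 0, Ext.zero_comp]

/-- The short exact sequence `0 ⟶ Y ⟶ I ⟶ I / Y ⟶ 0` with `I` injective. -/
noncomputable def injectiveCosyzygy (Y : G) : ShortComplex G :=
  ShortComplex.mk (Injective.ι Y) (cokernel.π (Injective.ι Y)) (cokernel.condition _)

theorem injectiveCosyzygy_shortExact (Y : G) : (injectiveCosyzygy Y).ShortExact where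
  exact := ShortComplex.exact_cokernel _
  mono_f := inferInstanceAs (Mono (Injective.ι Y))
  epi_g := inferInstanceAs (Epi (cokernel.π (Injective.ι Y)))

instance (Y : G) : Injective (injectiveCosyzygy Y).X₂ :=
  inferInstanceAs (Injective (Injective.under Y))

/-- A monomorphism whose cokernel `X` satisfies `Ext¹(X, Y) = 0` lifts against an epimorphism with
kernel `Y` and injective source. -/
theorem hasLiftingProperty_of_subsingleton_ext {S T : ShortComplex G} (hS : S.ShortExact)
    (hT : T.ShortExact) [Injective T.X₂] (h : Subsingleton (Ext S.X₃ T.X₁ 1)) :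
    HasLiftingProperty S.f T.g where
  sq_hasLift {t b} sq := by
    have := hS.mono_f
    have := hS.epi_g
    let e := Injective.factorThru t S.f
    have he : S.f ≫ e = t := Injective.comp_factorThru _ _
    obtain ⟨c, hc⟩ : ∃ c : S.X₃ ⟶ T.X₃, S.g ≫ c = b - e ≫ T.g := by
      refine ⟨hS.exact.desc (b - e ≫ T.g) ?_, hS.exact.g_desc _ _⟩
      rw [Preadditive.comp_sub, ← sq.w, ← Category.assoc, he, sub_self]
    obtain ⟨l, hl⟩ := exists_lift_of_subsingleton_ext hT h c
    refine ⟨⟨⟨e + S.g ≫ l, ?_, ?_⟩⟩⟩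
    · rw [Preadditive.comp_add, he, ← Category.assoc, S.zero, zero_comp, add_zero]
    · rw [Preadditive.add_comp, Category.assoc, hl, hc, add_sub_cancel]

/-- A monotone family of subobjects, as a functor. -/
noncomputable def monoOverOfMonotone {P : G} {J : Type u} [Preorder J] {N : J → Subobject P}
    (hN : Monotone N) : J ⥤ MonoOver P where
  obj j := MonoOver.mk (N j).arrow
  map f := MonoOver.homMk (Subobject.ofLE _ _ (hN (leOfHom f)))

variable {W F : ObjectProperty G}

/-- Eklof's lemma, for a continuous well-ordered chain of subobjects that all lie in the thick
class `W`: the successive quotients lie in `W` as well, so that lifts against an epimorphism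
`I ⟶ I / Y` with `Y` in `F` and `I` injective can be built by transfinite recursion. -/
theorem IsInjectiveCotorsionPair.iSup_chain_mem (h : IsInjectiveCotorsionPair W F) {P : G}
    {J : Type u} [LinearOrder J] [OrderBot J] [SuccOrder J] [WellFoundedLT J]
    {N : J → Subobject P} (hN : Monotone N)
    (hlim : ∀ m, Order.IsSuccLimit m → N m = ⨆ b : Set.Iio m, N b)
    (hW : ∀ j, W (N j : G)) : W ((⨆ j, N j : Subobject P) : G) := by
  refine (h.cotorsionPair.left_iff _).2 fun Y hY => ?_
  refine subsingleton_ext_of_exists_lift (injectiveCosyzygy_shortExact Y) fun f => ?_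
  let Φ : J ⥤ G := monoOverOfMonotone hN ⋙ MonoOver.forget _ ⋙ Over.forget _
  have hΦ : Φ.IsWellOrderContinuous := by
    refine ⟨fun m hm => ⟨?_⟩⟩
    have := hm.nonempty_Iio.to_subtype
    let c := (Set.principalSegIio m).cocone (monoOverOfMonotone hN ⋙ MonoOver.forget _)
    have : Mono c.pt.hom := inferInstanceAs (Mono (N m).arrow)
    apply IsGrothendieckAbelian.isColimitMapCoconeOfSubobjectMkEqISup
      ((Set.principalSegIio m).monotone.functor ⋙ monoOverOfMonotone hN) c
    change Subobject.mk (N m).arrow = ⨆ j : Set.Iio m, Subobject.mk (N j).arrow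
    simp only [Subobject.mk_arrow]
    exact hlim m hm
  let c : Cocone (monoOverOfMonotone hN ⋙ MonoOver.forget _) :=
    Cocone.mk (Over.mk (⨆ j, N j).arrow)
      { app j := Over.homMk (Subobject.ofLE _ _ (le_iSup N j)) (by simp [monoOverOfMonotone])
        naturality j j' f := by
          ext
          change Subobject.ofLE _ _ _ ≫ Subobject.ofLE _ _ _ = Subobject.ofLE _ _ _ ≫ 𝟙 _
          rw [Subobject.ofLE_comp_ofLE, Category.comp_id] }
  have : Mono c.pt.hom := inferInstanceAs (Mono (⨆ j, N j).arrow)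
  have hc : IsColimit ((Over.forget _).mapCocone c) := by
    apply IsGrothendieckAbelian.isColimitMapCoconeOfSubobjectMkEqISup
    change Subobject.mk (⨆ j, N j).arrow = ⨆ j : J, Subobject.mk (N j).arrow
    simp only [Subobject.mk_arrow]
  have key := HasLiftingProperty.transfiniteComposition.hasLiftingProperty_ι_app_bot
    (F := Φ) (p := (injectiveCosyzygy Y).g) (hc := hc) (fun j hj => by
      have hle : N j ≤ N (Order.succ j) := hN (Order.le_succ j)
      have hS := shortExact_cokernel_ofLE hle
      exact hasLiftingProperty_of_subsingleton_ext hS (injectiveCosyzygy_shortExact Y)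
        ((h.cotorsionPair.left_iff _).1 (h.thick.right _ hS (hW _) (hW _)) _ hY))
  obtain ⟨g₀, hg₀⟩ := exists_lift_of_subsingleton_ext (injectiveCosyzygy_shortExact Y)
    ((h.cotorsionPair.left_iff _).1 (hW ⊥) _ hY) (((Over.forget _).mapCocone c).ι.app ⊥ ≫ f)
  have sq : CommSq g₀ (((Over.forget _).mapCocone c).ι.app ⊥) (injectiveCosyzygy Y).g f := ⟨hg₀⟩
  obtain ⟨⟨l⟩⟩ := key.sq_hasLift sq
  exact ⟨l.l, l.fac_right⟩

end OrthogonalClass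

/-! ### Directed unions of objects of the left class -/

section DirectedUnions

/-- A directed family can be reindexed monotonically by the finite subsets of its index type. -/
theorem Directed.exists_monotone_finset {α J : Type*} [Preorder α] [Nonempty J] {S : J → α}
    (hS : Directed (· ≤ ·) S) :
    ∃ f : Finset J → J, Monotone (S ∘ f) ∧ ∀ (s : Finset J), ∀ i ∈ s, S i ≤ S (f s) := by
  classical
  have bound (s : Finset J) (g : ∀ t, t ⊂ s → J) :
      ∃ j, (∀ t ht, S (g t ht) ≤ S j) ∧ ∀ i ∈ s, S i ≤ S j := by
    obtain ⟨j, hj⟩ := hS.finset_le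
      (s ∪ s.ssubsets.attach.image fun t : {t // t ∈ s.ssubsets} =>
        g t.1 (Finset.mem_ssubsets.1 t.2))
    refine ⟨j, fun t ht => hj _ ?_, fun i hi => hj _ (Finset.mem_union_left _ hi)⟩
    exact Finset.mem_union_right _
      (Finset.mem_image.2 ⟨⟨t, Finset.mem_ssubsets.2 ht⟩, Finset.mem_attach _ _, rfl⟩)
  let f : Finset J → J := Finset.strongInduction fun s g => (bound s g).choose
  have hf (s : Finset J) : f s = (bound s fun t _ => f t).choose :=
    Finset.strongInduction_eq _ _
  refine ⟨f, fun t s hts => ?_, fun s i hi => ?_⟩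
  · rcases eq_or_ssubset_of_subset hts with rfl | h
    · exact le_rfl
    · simp only [Function.comp_apply]
      rw [hf s]
      exact (bound s fun t _ => f t).choose_spec.1 t h
  · rw [hf s]
    exact (bound s fun t _ => f t).choose_spec.2 i hi

theorem Finset.exists_forall_lt_of_noMax {J : Type*} [LinearOrder J] {X : Set J}
    (hne : X.Nonempty) (hX : ∀ c ∈ X, ∃ b ∈ X, c < b) (s : Finset J) (hs : (s : Set J) ⊆ X) :
    ∃ b ∈ X, (s : Set J) ⊆ Set.Iio b := by
  rcases s.eq_empty_or_nonempty with rfl | h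
  · obtain ⟨b, hb⟩ := hne
    exact ⟨b, hb, by simp⟩
  · obtain ⟨b, hb, hlt⟩ := hX _ (hs (s.max'_mem h))
    exact ⟨b, hb, fun c hc => (s.le_max' c hc).trans_lt hlt⟩

variable {G : Type*} [Category.{u} G] [Abelian G] [IsGrothendieckAbelian.{u} G]
variable {W F : ObjectProperty G}

/-- The supremum of the members of a family indexed by the finite subsets of `J` whose index is
contained in `I`. -/
noncomputable def supOfFinsetsIn {P : G} {J : Type u} (S : Finset J → Subobject P) (I : Set J) :
    Subobject P :=
  ⨆ s : {s : Finset J // (s : Set J) ⊆ I}, S s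

theorem supOfFinsetsIn_mono {P : G} {J : Type u} (S : Finset J → Subobject P) :
    Monotone (supOfFinsetsIn S) :=
  fun _ I' h => iSup_le fun s =>
    le_iSup (fun s : {s : Finset J // (s : Set J) ⊆ I'} => S s) ⟨s.1, s.2.trans h⟩

theorem le_supOfFinsetsIn {P : G} {J : Type u} (S : Finset J → Subobject P) {I : Set J}
    {s : Finset J} (hs : (s : Set J) ⊆ I) : S s ≤ supOfFinsetsIn S I :=
  le_iSup (fun s : {s : Finset J // (s : Set J) ⊆ I} => S s) ⟨s, hs⟩

/-- The transfinite step: an initial segment `I` with greatest element `b` is handled by the family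
`s ↦ S (insert b s)` over a smaller segment, and one without greatest element by a continuous
chain. -/
theorem IsInjectiveCotorsionPair.supOfFinsetsIn_mem_step (h : IsInjectiveCotorsionPair W F) {P : G}
    {J : Type u} [LinearOrder J] [WellFoundedLT J] {I : Set J} (hI : IsLowerSet I)
    (ih : ∀ a ∈ I, ∀ S : Finset J → Subobject P, Monotone S → (∀ s, W (S s : G)) →
      W (supOfFinsetsIn S (Set.Iio a) : G))
    {S : Finset J → Subobject P} (hS : Monotone S) (hW : ∀ s, W (S s : G)) :
    W (supOfFinsetsIn S I : G) := by
  classical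
  rcases I.eq_empty_or_nonempty with rfl | hne
  · have : supOfFinsetsIn S ∅ = S ∅ := by
      refine le_antisymm (iSup_le fun s => ?_) (le_supOfFinsetsIn S (by simp))
      have : s.1 = ∅ := by simpa using s.2
      rw [this]
    rw [this]
    exact hW _
  by_cases hmax : ∃ b ∈ I, ∀ c ∈ I, c ≤ b
  · obtain ⟨b, hb, hmax⟩ := hmax
    have : supOfFinsetsIn S I = supOfFinsetsIn (fun s => S (insert b s)) (Set.Iio b) := by
      refine le_antisymm (iSup_le fun s => ?_) (iSup_le fun s => le_supOfFinsetsIn S ?_)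
      · have hle : S s.1 ≤ S (insert b (s.1.erase b)) :=
          hS fun x hx => by
            by_cases hxb : x = b
            · simp [hxb]
            · simp [hxb, hx]
        refine hle.trans (le_supOfFinsetsIn (fun s => S (insert b s)) ?_)
        intro x hx
        have hx' : x ≠ b ∧ x ∈ s.1 := Finset.mem_erase.1 (Finset.mem_coe.1 hx)
        exact lt_of_le_of_ne (hmax x (s.2 hx'.2)) hx'.1
      · intro x hx
        have hx' : x = b ∨ x ∈ s.1 := by simpa using hx
        rcases hx' with rfl | hx'
        · exact hb
        · exact hI (le_of_lt (s.2 hx')) hb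
    rw [this]
    exact ih b hb _ (fun s t hst => hS (Finset.insert_subset_insert b hst)) fun s => hW _
  · push Not at hmax
    have := hne.to_subtype
    let _ : OrderBot I := WellFoundedLT.toOrderBot _
    let _ : SuccOrder I := SuccOrder.ofLinearWellFoundedLT _
    have hsup : supOfFinsetsIn S I = ⨆ b : I, supOfFinsetsIn S (Set.Iio b.1) := by
      refine le_antisymm (iSup_le fun s => ?_) (iSup_le fun b => supOfFinsetsIn_mono S ?_)
      · obtain ⟨b, hb, hsb⟩ := Finset.exists_forall_lt_of_noMax hne hmax s.1 s.2
        exact (le_supOfFinsetsIn S hsb).trans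
          (le_iSup (fun b : I => supOfFinsetsIn S (Set.Iio b.1)) ⟨b, hb⟩)
      · exact fun x hx => hI (le_of_lt hx) b.2
    rw [hsup]
    refine h.iSup_chain_mem (N := fun b : I => supOfFinsetsIn S (Set.Iio b.1)) ?_ ?_ ?_
    · exact fun a b hab => supOfFinsetsIn_mono S (Set.Iio_subset_Iio hab)
    · intro m hm
      refine le_antisymm (iSup_le fun s => ?_) (iSup_le fun b => supOfFinsetsIn_mono S ?_)
      · obtain ⟨b, hb, hsb⟩ := Finset.exists_forall_lt_of_noMax (X := Set.Iio m.1)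
          (by obtain ⟨b, hb⟩ := hm.nonempty_Iio; exact ⟨b.1, hb⟩)
          (fun c hc => by
            obtain ⟨b, hcb, hbm⟩ :=
              (not_covBy_iff (a := (⟨c, hI (le_of_lt hc) m.2⟩ : I)) (b := m) hc).1 (hm.2 _)
            exact ⟨b.1, hbm, hcb⟩) s.1 s.2
        exact (le_supOfFinsetsIn S hsb).trans
          (le_iSup (fun b : Set.Iio m => supOfFinsetsIn S (Set.Iio b.1.1))
            ⟨⟨b, hI (le_of_lt hb) m.2⟩, hb⟩)
      · exact Set.Iio_subset_Iio (le_of_lt (Set.mem_Iio.1 b.2))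
    · exact fun b => ih b.1 b.2 S hS hW

/-- The subobjects that lie in the left class of an injective cotorsion pair are closed under
directed unions. -/
theorem IsInjectiveCotorsionPair.iSup_directed_mem (h : IsInjectiveCotorsionPair W F) {P : G}
    {J : Type u} [Nonempty J] {S : J → Subobject P} (hS : Directed (· ≤ ·) S)
    (hW : ∀ j, W (S j : G)) : W ((⨆ j, S j : Subobject P) : G) := by
  classical
  obtain ⟨f, hf, hf'⟩ := hS.exists_monotone_finset
  let _ : LinearOrder J := linearOrderOfSTO (WellOrderingRel (α := J))
  have : WellFoundedLT J := ⟨WellOrderingRel.isWellOrder.wf⟩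
  have key (a : J) : ∀ S : Finset J → Subobject P, Monotone S → (∀ s, W (S s : G)) →
      W (supOfFinsetsIn S (Set.Iio a) : G) := by
    induction a using WellFoundedLT.induction with
    | ind a ih =>
      exact fun S hS hW => h.supOfFinsetsIn_mem_step (isLowerSet_Iio a) ih hS hW
  have : ⨆ j, S j = supOfFinsetsIn (S ∘ f) Set.univ := by
    refine le_antisymm (iSup_le fun j => ?_) (iSup_le fun s => le_iSup S (f s.1))
    exact (hf' {j} j (by simp)).trans (le_supOfFinsetsIn (S ∘ f) (Set.subset_univ _))
  rw [this]
  exact h.supOfFinsetsIn_mem_step isLowerSet_univ (fun a _ => key a) hf fun s => hW _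

end DirectedUnions

/-! ### Character modules over a ring that need not be commutative -/

section CharacterModules

variable {R : Type u} [Ring R]

/-- The character module of a right module is a left module. -/
instance leftCharacterModule {A : Type u} [AddCommGroup A] [Module Rᵐᵒᵖ A] :
    Module R (CharacterModule A) where
  smul r ξ := AddMonoidHom.comp ξ (DistribSMul.toAddMonoidHom A (MulOpposite.op r))
  one_smul ξ := CharacterModule.ext _ fun a => congrArg ξ (one_smul _ a)
  mul_smul _ s ξ := CharacterModule.ext _ fun a => congrArg ξ (mul_smul (MulOpposite.op s) _ a)
  smul_zero _ := rfl
  smul_add _ _ _ := rfl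
  add_smul r _ ξ := CharacterModule.ext _ fun a =>
    (congrArg ξ (add_smul (MulOpposite.op r) _ a)).trans (map_add ξ _ _)
  zero_smul ξ := CharacterModule.ext _ fun a =>
    (congrArg ξ (zero_smul Rᵐᵒᵖ a)).trans (map_zero ξ)

theorem leftCharacterModule_smul_apply {A : Type u} [AddCommGroup A] [Module Rᵐᵒᵖ A] (r : R)
    (ξ : CharacterModule A) (a : A) : (r • ξ) a = ξ (MulOpposite.op r • a) := rfl

/-- The character module of a left module is a right module. -/
instance rightCharacterModule {M : Type u} [AddCommGroup M] [Module R M] :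
    Module Rᵐᵒᵖ (CharacterModule M) where
  smul r χ := AddMonoidHom.comp χ (DistribSMul.toAddMonoidHom M r.unop)
  one_smul χ := CharacterModule.ext _ fun m => congrArg χ (one_smul R m)
  mul_smul r s χ := CharacterModule.ext _ fun m => congrArg χ (mul_smul s.unop r.unop m)
  smul_zero _ := rfl
  smul_add _ _ _ := rfl
  add_smul r s χ := CharacterModule.ext _ fun m =>
    (congrArg χ (add_smul r.unop s.unop m)).trans (map_add χ _ _)
  zero_smul χ := CharacterModule.ext _ fun m =>
    (congrArg χ (zero_smul R m)).trans (map_zero χ)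

theorem exists_character_extension {A B : Type u} [AddCommGroup A] [AddCommGroup B] (f : A →+ B)
    (φ : CharacterModule A) (h : ∀ a, f a = 0 → φ a = 0) :
    ∃ ψ : CharacterModule B, ∀ a, ψ (f a) = φ a := by
  let φ' : (A ⧸ LinearMap.ker f.toIntLinearMap) →ₗ[ℤ] AddCircle (1 : ℚ) :=
    Submodule.liftQ _ (AddMonoidHom.toIntLinearMap φ) fun a ha => h a ha
  let f' : (A ⧸ LinearMap.ker f.toIntLinearMap) →ₗ[ℤ] B :=
    Submodule.liftQ _ f.toIntLinearMap le_rfl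
  have hf' : Function.Injective f' :=
    LinearMap.ker_eq_bot.1 (Submodule.ker_liftQ_eq_bot _ _ _ le_rfl)
  obtain ⟨ψ, hψ⟩ := CharacterModule.dual_surjective_of_injective f' hf' φ'.toAddMonoidHom
  exact ⟨ψ, fun a => DFunLike.congr_fun hψ (Submodule.Quotient.mk a)⟩

/-- The left module `M` satisfies this condition if its character module is an injective right
module. The condition is expressed through homomorphisms from `M` to the character modules of right
modules, the transposes of the homomorphisms from right modules to the character module of `M`. -/
def HasInjectiveDual (R : Type u) [Ring R] (M : Type u) [AddCommGroup M] [Module R M] : Prop :=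
  ∀ ⦃A B : Type u⦄ [AddCommGroup A] [Module Rᵐᵒᵖ A] [AddCommGroup B] [Module Rᵐᵒᵖ B]
    (f : A →ₗ[Rᵐᵒᵖ] B), Function.Injective f → ∀ h : M →ₗ[R] CharacterModule A,
      ∃ g : M →ₗ[R] CharacterModule B, ∀ m a, g m (f a) = h m a

variable {M : Type u} [AddCommGroup M] [Module R M]

theorem HasInjectiveDual.exists_extension (hM : HasInjectiveDual R M) {A B : Type u}
    [AddCommGroup A] [Module Rᵐᵒᵖ A] [AddCommGroup B] [Module Rᵐᵒᵖ B] (f : A →ₗ[Rᵐᵒᵖ] B)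
    (h : M →ₗ[R] CharacterModule A) (hf : ∀ a, f a = 0 → ∀ m, h m a = 0) :
    ∃ g : M →ₗ[R] CharacterModule B, ∀ m a, g m (f a) = h m a := by
  let f' : (A ⧸ LinearMap.ker f) →ₗ[Rᵐᵒᵖ] B := Submodule.liftQ _ f le_rfl
  have hf' : Function.Injective f' :=
    LinearMap.ker_eq_bot.1 (Submodule.ker_liftQ_eq_bot _ _ _ le_rfl)
  let h' : M →ₗ[R] CharacterModule (A ⧸ LinearMap.ker f) :=
    { toFun m := (QuotientAddGroup.lift (LinearMap.ker f).toAddSubgroup (h m)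
        fun a ha => hf a ha m : (A ⧸ LinearMap.ker f) →+ AddCircle (1 : ℚ))
      map_add' m m' := CharacterModule.ext _ fun a => by
        obtain ⟨a, rfl⟩ := Submodule.Quotient.mk_surjective _ a
        exact DFunLike.congr_fun (h.map_add m m') a
      map_smul' r m := CharacterModule.ext _ fun a => by
        obtain ⟨a, rfl⟩ := Submodule.Quotient.mk_surjective _ a
        exact DFunLike.congr_fun (h.map_smul r m) a }
  obtain ⟨g, hg⟩ := hM f' hf' h'
  exact ⟨g, fun m a => hg m (Submodule.Quotient.mk a)⟩

/-- A homomorphism `M → A⁺` amounts to a character of `A ⊗_R M`, and characters extend along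
injective homomorphisms. -/
theorem IsFlatModule.hasInjectiveDual {M : ModuleCat.{u} R} (hM : IsFlatModule M) :
    HasInjectiveDual R M := by
  intro A B _ _ _ _ f hf h
  let φ₀ : A ⊗[ℤ] M →ₗ[ℤ] AddCircle (1 : ℚ) :=
    TensorProduct.lift (LinearMap.mk₂ ℤ (fun a m => h m a)
      (fun a a' m => map_add (h m) a a') (fun n a m => map_zsmul (h m) n a)
      (fun a m m' => DFunLike.congr_fun (h.map_add m m') a)
      (fun n a m => DFunLike.congr_fun (map_zsmul h n m) a))
  have hφ₀ : NCTensor.relations R A M ≤ LinearMap.ker φ₀ := by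
    refine Submodule.span_le.2 ?_
    rintro _ ⟨a, r, m, rfl⟩
    have h₁ : φ₀ ((MulOpposite.op r • a) ⊗ₜ m) = φ₀ (a ⊗ₜ (r • m)) :=
      (DFunLike.congr_fun (h.map_smul r m) a).symm
    exact (map_sub φ₀ _ _).trans (sub_eq_zero.2 h₁)
  let φ : NCTensor.Tensor R A M →ₗ[ℤ] AddCircle (1 : ℚ) := Submodule.liftQ _ φ₀ hφ₀
  obtain ⟨ψ, hψ⟩ := CharacterModule.dual_surjective_of_injective
    (NCTensor.tensorMap f (LinearMap.id : M →ₗ[R] M))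
    (hM (A := ModuleCat.of _ A) (B := ModuleCat.of _ B) f hf) φ.toAddMonoidHom
  refine ⟨{ toFun m := AddMonoidHom.mk' (fun b => ψ (Submodule.Quotient.mk (b ⊗ₜ[ℤ] m)))
              fun b b' => by rw [TensorProduct.add_tmul, Submodule.Quotient.mk_add, map_add]
            map_add' m m' := CharacterModule.ext _ fun b => ?_
            map_smul' r m := CharacterModule.ext _ fun b => ?_ }, fun m a => ?_⟩
  · change ψ _ = ψ _ + ψ _
    rw [TensorProduct.tmul_add, Submodule.Quotient.mk_add, map_add]
  · change ψ _ = ψ _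
    congr 1
    have hmem : (MulOpposite.op r • b) ⊗ₜ[ℤ] m - b ⊗ₜ[ℤ] (r • m) ∈ NCTensor.relations R B M :=
      Submodule.subset_span ⟨b, r, m, rfl⟩
    exact ((Submodule.Quotient.eq _).2 hmem).symm
  · exact DFunLike.congr_fun hψ (Submodule.Quotient.mk (a ⊗ₜ[ℤ] m))

theorem HasInjectiveDual.of_linearEquiv {N : Type u} [AddCommGroup N] [Module R N]
    (hM : HasInjectiveDual R M) (e : M ≃ₗ[R] N) : HasInjectiveDual R N := by
  intro A B _ _ _ _ f hf h
  obtain ⟨g, hg⟩ := hM f hf (h ∘ₗ e.toLinearMap)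
  exact ⟨g ∘ₗ e.symm.toLinearMap, fun m a => by simp [hg]⟩

theorem HasInjectiveDual.of_subsingleton [Subsingleton M] : HasInjectiveDual R M :=
  fun _ _ _ _ _ _ f _ h => ⟨0, fun m a => by
    rw [Subsingleton.elim m 0, map_zero, map_zero]; rfl⟩

/-- The equational criterion for flatness: a solution in `Z` of a linear equation is the image of a
solution in any module that maps onto `Z`. A character that separates the given solution from
these images would be induced by a homomorphism from `Z` to the character module of `R`, hence
would vanish on every solution in `Z`. -/
theorem HasInjectiveDual.exists_lift_solution {Z H : Type u} [AddCommGroup Z] [Module R Z]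
    [AddCommGroup H] [Module R H] (hZ : HasInjectiveDual R Z) {q : H →ₗ[R] Z}
    (hq : Function.Surjective q) {ι : Type u} [Fintype ι] (r : ι → R) (z : ι → Z)
    (hz : ∑ i, r i • z i = 0) : ∃ y : ι → H, (∀ i, q (y i) = z i) ∧ ∑ i, r i • y i = 0 := by
  classical
  let T : AddSubgroup (ι → H) :=
    (AddMonoidHom.mk' (fun y : ι → H => ∑ i, r i • y i)
      fun y y' => by simp [smul_add, Finset.sum_add_distrib]).ker
  let Q : (ι → H) →+ (ι → Z) := AddMonoidHom.mk' (fun y i => q (y i)) fun y y' => by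
    ext i; simp
  let T' : Submodule ℤ (ι → Z) := AddSubgroup.toIntSubmodule (T.map Q)
  suffices h : z ∈ T.map Q by
    obtain ⟨y, hy, hyz⟩ := h
    exact ⟨y, fun i => congrFun hyz i, hy⟩
  by_contra hzT
  have hne : (Submodule.Quotient.mk z : (ι → Z) ⧸ T') ≠ 0 := fun h =>
    hzT ((Submodule.Quotient.mk_eq_zero T').1 h)
  obtain ⟨c, hc⟩ := CharacterModule.exists_character_apply_ne_zero_of_ne_zero hne
  let χ : CharacterModule (ι → Z) := AddMonoidHom.comp c T'.mkQ.toAddMonoidHom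
  have hχT (y : ι → H) (hy : ∑ i, r i • y i = 0) : χ (fun i => q (y i)) = 0 := by
    have : (Submodule.Quotient.mk (fun i => q (y i)) : (ι → Z) ⧸ T') = 0 :=
      (Submodule.Quotient.mk_eq_zero T').2 ⟨y, hy, rfl⟩
    exact (congrArg c this).trans (map_zero c)
  let f : (ι → R) →ₗ[Rᵐᵒᵖ] R :=
    { toFun x := ∑ i, r i * x i
      map_add' x x' := by simp [mul_add, Finset.sum_add_distrib]
      map_smul' s x := by
        simp [Finset.sum_mul, mul_assoc] }
  let h : Z →ₗ[R] CharacterModule (ι → R) :=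
    { toFun w := AddMonoidHom.mk' (fun x => χ fun i => x i • w) fun x x' => by
        rw [← map_add]; congr 1; ext i; simp [add_smul]
      map_add' w w' := CharacterModule.ext _ fun x => by
        change χ _ = χ _ + χ _
        rw [← map_add]; congr 1; ext i; simp
      map_smul' s w := CharacterModule.ext _ fun x => by
        change χ _ = χ _
        congr 1; ext i; simp [mul_smul] }
  obtain ⟨g, hg⟩ := hZ.exists_extension f h fun x hx w => by
    obtain ⟨y, rfl⟩ := hq w
    change χ (fun i => x i • q y) = 0
    have := hχT (fun i => x i • y) (by
      have hx' : ∑ i, r i * x i = 0 := hx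
      simp_rw [smul_smul]
      rw [← Finset.sum_smul, hx', zero_smul])
    simpa using this
  have hval (i : ι) : χ (Pi.single i (z i)) = g (r i • z i) (1 : R) := by
    have h1 := hg (z i) (Pi.single i 1)
    have h2 : f (Pi.single i 1) = r i := by
      change ∑ j, r j * (Pi.single i (1 : R) : ι → R) j = r i
      simp [Pi.single_apply]
    rw [h2] at h1
    rw [map_smul, leftCharacterModule_smul_apply]
    have h3 : MulOpposite.op (r i) • (1 : R) = r i := by simp
    rw [h3, h1]
    change _ = χ fun j => (Pi.single i (1 : R) : ι → R) j • z i
    congr 1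
    ext j
    by_cases hj : j = i
    · subst hj; simp
    · simp [hj]
  refine hc ?_
  change χ z = 0
  have hsum : z = ∑ i, Pi.single i (z i) := (Finset.univ_sum_single z).symm
  have hz0 : χ z = ∑ i, χ (Pi.single i (z i)) := by
    conv_lhs => rw [hsum]
    exact map_sum χ _ _
  rw [hz0]
  simp_rw [hval]
  have : ∑ i, g (r i • z i) (1 : R) = g (∑ i, r i • z i) (1 : R) := by
    rw [map_sum]
    exact (map_sum (AddMonoidHom.eval (1 : R)) _ _).symm
  rw [this, hz, map_zero]
  rfl

/-- A homomorphism from a free module to a flat module lifts along an epimorphism in such a way that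
a given element of its kernel goes to zero. -/
theorem HasInjectiveDual.exists_lift_kernel {Z H ι : Type u} [AddCommGroup Z] [Module R Z]
    [AddCommGroup H] [Module R H] (hZ : HasInjectiveDual R Z) {q : H →ₗ[R] Z}
    (hq : Function.Surjective q) (σ : (ι →₀ R) →ₗ[R] Z) (x : ι →₀ R) (hx : σ x = 0) :
    ∃ v : (ι →₀ R) →ₗ[R] H, q ∘ₗ v = σ ∧ v x = 0 := by
  classical
  obtain ⟨y, hy, hy0⟩ := hZ.exists_lift_solution hq (fun i : x.support => x i)
    (fun i => σ (Finsupp.single i.1 1)) (by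
      rw [Finset.sum_coe_sort x.support (fun i => x i • σ (Finsupp.single i 1))]
      rw [← hx]
      conv_rhs => rw [← Finsupp.sum_single x]
      rw [Finsupp.sum, map_sum]
      exact Finset.sum_congr rfl fun i _ => by rw [← map_smul]; simp)
  choose l hl using hq
  let y' : ι → H := fun i => if h : i ∈ x.support then y ⟨i, h⟩ else l (σ (Finsupp.single i 1))
  refine ⟨Finsupp.linearCombination R y', ?_, ?_⟩
  · refine Finsupp.lhom_ext' fun i => LinearMap.ext_ring ?_
    simp only [LinearMap.comp_apply, Finsupp.lsingle_apply, Finsupp.linearCombination_single,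
      one_smul, y']
    split_ifs with h
    · exact hy ⟨i, h⟩
    · exact hl _
  · rw [Finsupp.linearCombination_apply, Finsupp.sum, ← Finset.sum_coe_sort, ← hy0]
    refine Finset.sum_congr rfl fun i _ => ?_
    simp only [y', dif_pos i.2]

end CharacterModules

/-! ### Disc complexes -/

section DiscComplexes

variable {R : Type u} [Ring R]

theorem acyclic_iff_exists {S : Type*} [Ring S] (X : ChainComplex (ModuleCat.{u} S) ℤ) :
    X.Acyclic ↔ ∀ i j k : ℤ, j + 1 = i → k + 1 = j → ∀ x : X.X j, X.d j k x = 0 →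
      ∃ y : X.X i, X.d i j y = x := by
  constructor
  · intro h i j k hi hk x hx
    have := (X.exactAt_iff' i j k (ComplexShape.prev_eq' _ hi) (ComplexShape.next_eq' _ hk)).1 (h j)
    exact ((ShortComplex.moduleCat_exact_iff _).1 this) x hx
  · intro h j
    refine (X.exactAt_iff' (j + 1) j (j - 1) (by simp) (by simp)).2 ?_
    exact (ShortComplex.moduleCat_exact_iff _).2 fun x hx => h _ _ _ rfl (by lia) x hx

theorem d_apply_d_apply (X : ChainComplex (ModuleCat.{u} R) ℤ) (i j k : ℤ) (x : X.X i) :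
    X.d j k (X.d i j x) = 0 :=
  DFunLike.congr_fun (congrArg ModuleCat.Hom.hom (X.d_comp_d i j k)) x

theorem hom_f_d_apply {X Y : ChainComplex (ModuleCat.{u} R) ℤ} (f : X ⟶ Y) (i j : ℤ) (x : X.X i) :
    f.f j (X.d i j x) = Y.d i j (f.f i x) :=
  (DFunLike.congr_fun (congrArg ModuleCat.Hom.hom (f.comm i j)) x).symm

/-- A chain map given by linear maps that commute with the differentials. -/
def chainMapOfLinear {X Y : ChainComplex (ModuleCat.{u} R) ℤ} (f : ∀ n, X.X n →ₗ[R] Y.X n)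
    (hf : ∀ n (x : X.X (n + 1)), f n (X.d (n + 1) n x) = Y.d (n + 1) n (f (n + 1) x)) : X ⟶ Y where
  f n := ModuleCat.ofHom (f n)
  comm' i j hij := by
    obtain rfl : j + 1 = i := hij
    ext x
    exact (hf j x).symm

variable (M : ℤ → Type u) [∀ n, AddCommGroup (M n)] [∀ n, Module R (M n)]

/-- The contractible complex with `M n × M (n + 1)` in degree `n` and differential
`(a, b) ↦ (0, a)`. Chain maps out of it are families of linear maps `M n → X_n`, and chain maps into
it are families of linear maps `X_n → M (n + 1)`. -/
def discComplex : ChainComplex (ModuleCat.{u} R) ℤ :=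
  ChainComplex.of (fun n => ModuleCat.of R (M n × M (n + 1)))
    (fun n => ModuleCat.ofHom (LinearMap.inr R (M n) (M (n + 1)) ∘ₗ
      LinearMap.fst R (M (n + 1)) (M (n + 1 + 1))))
    (fun n => by ext x <;> rfl)

variable {M}

variable (R M) in
/-- The components of a disc complex. -/
def discEquiv (n : ℤ) : (M n × M (n + 1)) ≃ₗ[R] (discComplex (R := R) M).X n :=
  LinearEquiv.refl R _

theorem discComplex_d_apply (n : ℤ) (x : M (n + 1) × M (n + 1 + 1)) :
    (discComplex (R := R) M).d (n + 1) n (discEquiv R M (n + 1) x) = discEquiv R M n (0, x.1) := by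
  have h : (discComplex (R := R) M).d (n + 1) n = ModuleCat.ofHom
      (LinearMap.inr R (M n) (M (n + 1)) ∘ₗ LinearMap.fst R (M (n + 1)) (M (n + 1 + 1))) :=
    ChainComplex.of_d (V := ModuleCat.{u} R) (fun n => ModuleCat.of R (M n × M (n + 1)))
      (fun n => ModuleCat.ofHom (LinearMap.inr R (M n) (M (n + 1)) ∘ₗ
        LinearMap.fst R (M (n + 1)) (M (n + 1 + 1)))) n
  rw [h]
  rfl

theorem discComplex_d_eq_zero {n : ℤ} {x : M (n + 1) × M (n + 1 + 1)}
    (hx : (discComplex (R := R) M).d (n + 1) n (discEquiv R M (n + 1) x) = 0) : x.1 = 0 := by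
  rw [discComplex_d_apply] at hx
  exact congrArg Prod.snd ((discEquiv R M n).injective (hx.trans (map_zero _).symm))

variable {X : ChainComplex (ModuleCat.{u} R) ℤ}

/-- The chain map out of a disc complex that extends a family of linear maps. -/
def discDesc (φ : ∀ n, M n →ₗ[R] X.X n) : discComplex (R := R) M ⟶ X :=
  chainMapOfLinear
    (fun n => LinearMap.coprod (φ n) ((X.d (n + 1) n).hom ∘ₗ φ (n + 1)) ∘ₗ
      (discEquiv R M n).symm.toLinearMap)
    (fun n x => by
      obtain ⟨⟨a, b⟩, rfl⟩ := (discEquiv R M (n + 1)).surjective x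
      rw [discComplex_d_apply]
      simp [d_apply_d_apply])

theorem discDesc_f_apply (φ : ∀ n, M n →ₗ[R] X.X n) (n : ℤ) (x : M n × M (n + 1)) :
    (discDesc φ).f n (discEquiv R M n x) = φ n x.1 + X.d (n + 1) n (φ (n + 1) x.2) := rfl

theorem discComplex_hom_apply (f : discComplex (R := R) M ⟶ X) (n : ℤ) (x : M n × M (n + 1)) :
    f.f n (discEquiv R M n x) = f.f n (discEquiv R M n (x.1, 0)) +
      X.d (n + 1) n (f.f (n + 1) (discEquiv R M (n + 1) (x.2, 0))) := by
  rw [← hom_f_d_apply, discComplex_d_apply, ← map_add, ← map_add]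
  simp

theorem discComplex_hom_ext {f g : discComplex (R := R) M ⟶ X}
    (h : ∀ n (a : M n), f.f n (discEquiv R M n (a, 0)) = g.f n (discEquiv R M n (a, 0))) :
    f = g := by
  ext n x
  obtain ⟨x, rfl⟩ := (discEquiv R M n).surjective x
  rw [discComplex_hom_apply f, discComplex_hom_apply g, h, h]

/-- The chain map into a disc complex given by a family of linear maps that raise the degree. -/
def discLift (s : ∀ i j, i + 1 = j → X.X i →ₗ[R] M j) : X ⟶ discComplex (R := R) M :=
  chainMapOfLinear
    (fun n => (discEquiv R M n).toLinearMap ∘ₗ LinearMap.prod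
      (s (n - 1) n (by lia) ∘ₗ (X.d n (n - 1)).hom) (s n (n + 1) rfl))
    (fun n x => by
      have h (m : ℤ) (hm : m = n) (hm' : m + 1 = n + 1) :
          s n (n + 1) rfl (X.d (n + 1) n x) = s m (n + 1) hm' (X.d (n + 1) m x) := by
        subst hm; rfl
      refine Eq.trans ?_ (discComplex_d_apply (R := R) n _).symm
      refine congrArg (discEquiv R M n) (Prod.ext ?_ (h _ (by lia) _))
      change s (n - 1) n _ (X.d n (n - 1) (X.d (n + 1) n x)) = 0
      rw [d_apply_d_apply, map_zero])

theorem discLift_f_apply (s : ∀ i j, i + 1 = j → X.X i →ₗ[R] M j) (n : ℤ) (x : X.X n) :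
    (discLift s).f n x =
      discEquiv R M n (s (n - 1) n (by lia) (X.d n (n - 1) x), s n (n + 1) rfl x) := rfl

theorem hom_f_surjective_of_epi {X Y : ChainComplex (ModuleCat.{u} R) ℤ} (f : X ⟶ Y) [Epi f]
    (n : ℤ) : Function.Surjective (f.f n) :=
  (ModuleCat.epi_iff_surjective _).1
    (inferInstanceAs (Epi ((HomologicalComplex.eval _ _ n).map f)))

variable (R) in
/-- The contractible complex with a basis consisting of the elements of the `B n` in degree `n` and
their boundaries. -/
noncomputable abbrev freeDisc (B : ℤ → Type u) : ChainComplex (ModuleCat.{u} R) ℤ :=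
  discComplex (R := R) fun n => B n →₀ R

variable {B : ℤ → Type u}

variable (R) in
/-- The generators of `freeDisc R B`. -/
noncomputable def freeDiscGen (n : ℤ) (b : B n) : (freeDisc R B).X n :=
  discEquiv R (fun n => B n →₀ R) n (Finsupp.single b 1, 0)

/-- The chain map with given values on the generators. -/
noncomputable def freeDiscDesc (l : ∀ n, B n → X.X n) : freeDisc R B ⟶ X :=
  discDesc fun n => Finsupp.linearCombination R (l n)

@[simp]
theorem freeDiscDesc_f_gen (l : ∀ n, B n → X.X n) (n : ℤ) (b : B n) :
    (freeDiscDesc l).f n (freeDiscGen R n b) = l n b := by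
  rw [freeDiscDesc, freeDiscGen, discDesc_f_apply]
  simp

theorem freeDisc_hom_apply_eq (f g : freeDisc R B ⟶ X) (n : ℤ) (c : B n →₀ R)
    (h : ∀ b ∈ c.support, f.f n (freeDiscGen R n b) = g.f n (freeDiscGen R n b)) :
    f.f n (discEquiv R (fun n => B n →₀ R) n (c, 0)) =
      g.f n (discEquiv R (fun n => B n →₀ R) n (c, 0)) := by
  let D : (B n →₀ R) →ₗ[R] (freeDisc R B).X n :=
    (discEquiv R (fun n => B n →₀ R) n).toLinearMap ∘ₗ LinearMap.inl R _ _
  have key (f : freeDisc R B ⟶ X) : f.f n (discEquiv R (fun n => B n →₀ R) n (c, 0)) =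
      c.sum fun b r => r • f.f n (freeDiscGen R n b) := by
    change ((f.f n).hom ∘ₗ D) c = _
    conv_lhs => rw [← Finsupp.sum_single c]
    rw [Finsupp.sum, map_sum]
    refine Finset.sum_congr rfl fun b _ => ?_
    rw [← mul_one (c b), ← smul_eq_mul, ← Finsupp.smul_single, map_smul, smul_eq_mul, mul_one]
    rfl
  rw [key f, key g]
  exact Finset.sum_congr rfl fun b hb => congrArg _ (h b hb)

theorem freeDisc_hom_ext {f g : freeDisc R B ⟶ X}
    (h : ∀ n b, f.f n (freeDiscGen R n b) = g.f n (freeDiscGen R n b)) : f = g :=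
  discComplex_hom_ext fun n c => freeDisc_hom_apply_eq f g n c fun b _ => h n b

theorem comp_f_apply {X Y Z : ChainComplex (ModuleCat.{u} R) ℤ} (f : X ⟶ Y) (g : Y ⟶ Z) (n : ℤ)
    (x : X.X n) : (f ≫ g).f n x = g.f n (f.f n x) := rfl

theorem congr_f_apply {X Y : ChainComplex (ModuleCat.{u} R) ℤ} {f g : X ⟶ Y} (h : f = g) (n : ℤ)
    (x : X.X n) : f.f n x = g.f n x := by rw [h]

instance freeDisc_projective : Projective (freeDisc R B) where
  factors {E X} f e _ := by
    choose l hl using fun (n : ℤ) (b : B n) =>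
      hom_f_surjective_of_epi e n (f.f n (freeDiscGen R n b))
    exact ⟨freeDiscDesc l, freeDisc_hom_ext fun n b => by
      rw [comp_f_apply, freeDiscDesc_f_gen, hl]⟩

/-! ### Trivial fibrations and approximation by exact complexes -/

/-- Chain maps with the lifting property against the inclusions of spheres into discs: the
epimorphisms with exact kernel. -/
def IsTrivialFibration {U V : ChainComplex (ModuleCat.{u} R) ℤ} (p : U ⟶ V) : Prop :=
  ∀ i j k : ℤ, j + 1 = i → k + 1 = j → ∀ (x : U.X j) (v : V.X i), U.d j k x = 0 →
    p.f j x = V.d i j v → ∃ w : U.X i, U.d i j w = x ∧ p.f i w = v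

theorem isTrivialFibration_of_isZero {U V : ChainComplex (ModuleCat.{u} R) ℤ} (hU : U.Acyclic)
    (hV : IsZero V) (p : U ⟶ V) : IsTrivialFibration p := by
  intro i j k hi hk x v hx _
  obtain ⟨w, hw⟩ := (acyclic_iff_exists U).1 hU i j k hi hk x hx
  have : Subsingleton (V.X i) :=
    ModuleCat.subsingleton_of_isZero ((HomologicalComplex.eval _ _ i).map_isZero hV)
  exact ⟨w, hw, Subsingleton.elim _ _⟩

theorem acyclic_of_isTrivialFibration {U V : ChainComplex (ModuleCat.{u} R) ℤ} {p : U ⟶ V}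
    (hV : IsZero V) (h : IsTrivialFibration p) : U.Acyclic := by
  rw [acyclic_iff_exists]
  intro i j k hi hk x hx
  have : Subsingleton (V.X j) :=
    ModuleCat.subsingleton_of_isZero ((HomologicalComplex.eval _ _ j).map_isZero hV)
  obtain ⟨w, hw, _⟩ := h i j k hi hk x 0 hx (Subsingleton.elim _ _)
  exact ⟨w, hw⟩

/-- The canonical epimorphism from a contractible complex to `Y`, whose kernel is a shift of `Y`.
Chain maps to `Y` that lift along it are the null-homotopic ones. -/
def discCounit (Y : ChainComplex (ModuleCat.{u} R) ℤ) :
    discComplex (R := R) (fun n => Y.X n) ⟶ Y :=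
  discDesc fun _ => LinearMap.id

theorem discCounit_f_apply (Y : ChainComplex (ModuleCat.{u} R) ℤ) (n : ℤ)
    (x : Y.X n × Y.X (n + 1)) :
    (discCounit Y).f n (discEquiv R (fun n => Y.X n) n x) = x.1 + Y.d (n + 1) n x.2 := rfl

theorem isTrivialFibration_discCounit {Y : ChainComplex (ModuleCat.{u} R) ℤ} (hY : Y.Acyclic) :
    IsTrivialFibration (discCounit Y) := by
  rintro _ _ k rfl rfl x v hx hv
  obtain ⟨⟨a, b⟩, rfl⟩ := (discEquiv R (fun n => Y.X n) (k + 1)).surjective x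
  obtain rfl : a = 0 := discComplex_d_eq_zero hx
  rw [discCounit_f_apply] at hv
  obtain ⟨c, hc⟩ := (acyclic_iff_exists Y).1 hY (k + 1 + 1 + 1) (k + 1 + 1) (k + 1) rfl rfl (v - b)
    (by rw [map_sub, ← hv]; simp)
  refine ⟨discEquiv R (fun n => Y.X n) (k + 1 + 1) (b, c),
    discComplex_d_apply (M := fun n => Y.X n) (k + 1) (b, c), ?_⟩
  rw [discCounit_f_apply]
  simp [hc]

theorem isTrivialFibration_disc {N : ℤ → Type u} [∀ n, AddCommGroup (N n)] [∀ n, Module R (N n)]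
    (p : discComplex (R := R) M ⟶ discComplex (R := R) N) (q : ∀ n, M n →ₗ[R] N n)
    (hp : ∀ n x, p.f n (discEquiv R M n x) = discEquiv R N n (q n x.1, q (n + 1) x.2))
    (hq : ∀ n, Function.Surjective (q n)) : IsTrivialFibration p := by
  rintro _ _ k rfl rfl x v hx hv
  obtain ⟨⟨a, b⟩, rfl⟩ := (discEquiv R M (k + 1)).surjective x
  obtain ⟨⟨v, v'⟩, rfl⟩ := (discEquiv R N (k + 1 + 1)).surjective v
  obtain rfl : a = 0 := discComplex_d_eq_zero hx
  rw [hp, discComplex_d_apply] at hv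
  obtain rfl : q (k + 1 + 1) b = v := congrArg Prod.snd ((discEquiv R N (k + 1)).injective hv)
  obtain ⟨c, rfl⟩ := hq _ v'
  exact ⟨discEquiv R M (k + 1 + 1) (b, c), discComplex_d_apply (k + 1) (b, c),
    hp (k + 1 + 1) (b, c)⟩

variable (R) in
/-- The direct sum of the spheres `Sⁿ(R)` over all `n`: the complex with `R` in every degree and
differential `0`. -/
def sphereSum : ChainComplex (ModuleCat.{u} R) ℤ :=
  ChainComplex.of (fun _ => ModuleCat.of R R) (fun _ => 0) (fun _ => zero_comp)

variable (R) in
/-- The components of `sphereSum R`. -/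
def sphereEquiv (n : ℤ) : R ≃ₗ[R] (sphereSum R).X n :=
  LinearEquiv.refl R _

theorem sphereSum_d (n : ℤ) : (sphereSum R).d (n + 1) n = 0 := by
  have h : (sphereSum R).d (n + 1) n = (0 : ModuleCat.of R R ⟶ ModuleCat.of R R) :=
    ChainComplex.of_d (V := ModuleCat.{u} R) (fun _ => ModuleCat.of R R) (fun _ => 0) n
  exact h

variable (R) in
/-- The direct sum of the inclusions of spheres into discs `Sⁿ(R) ⟶ Dⁿ⁺¹(R)` over all `n`. -/
def sphereSumToDisc : sphereSum R ⟶ discComplex (R := R) fun _ => R :=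
  chainMapOfLinear (fun n => (discEquiv R (fun _ => R) n).toLinearMap ∘ₗ LinearMap.inr R R R ∘ₗ
      (sphereEquiv R n).symm.toLinearMap) (fun n x => by
    rw [sphereSum_d]
    exact ((discComplex_d_apply (R := R) (M := fun _ => R) n _).trans (map_zero _)).symm)

theorem sphereSumToDisc_f_apply (n : ℤ) (x : R) :
    (sphereSumToDisc R).f n (sphereEquiv R n x) = discEquiv R (fun _ => R) n (0, x) := rfl

theorem sphereSum_hom_ext {f g : sphereSum R ⟶ X}
    (h : ∀ n, f.f n (sphereEquiv R n 1) = g.f n (sphereEquiv R n 1)) : f = g := by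
  ext n
  exact h n

theorem d_sphereSum_hom (f : sphereSum R ⟶ X) (n : ℤ) (x : (sphereSum R).X (n + 1)) :
    X.d (n + 1) n (f.f (n + 1) x) = 0 := by
  rw [← hom_f_d_apply, sphereSum_d]
  exact map_zero (f.f n).hom

theorem IsTrivialFibration.hasLiftingProperty {U V : ChainComplex (ModuleCat.{u} R) ℤ} {p : U ⟶ V}
    (hp : IsTrivialFibration p) : HasLiftingProperty (sphereSumToDisc R) p where
  sq_hasLift {t b} sq := by
    have hb (n : ℤ) : b.f n (discEquiv R (fun _ => R) n (0, 1)) = V.d (n + 1) n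
        (b.f (n + 1) (discEquiv R (fun _ => R) (n + 1) (1, 0))) := by
      rw [← hom_f_d_apply, discComplex_d_apply]
    have hsq (n : ℤ) : p.f n (t.f n (sphereEquiv R n 1)) =
        b.f n (discEquiv R (fun _ => R) n (0, 1)) :=
      congr_f_apply sq.w n (sphereEquiv R n 1)
    have hw (n m : ℤ) (hm : m + 1 = n) : ∃ w : U.X n, U.d n m w = t.f m (sphereEquiv R m 1) ∧
        p.f n w = b.f n (discEquiv R (fun _ => R) n (1, 0)) := by
      subst hm
      obtain ⟨k, rfl⟩ : ∃ k, k + 1 = m := ⟨m - 1, by lia⟩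
      exact hp _ _ k rfl rfl _ _ (d_sphereSum_hom t k _) ((hsq _).trans (hb _))
    have hw' (n : ℤ) : ∃ w : U.X n, (∀ m, m + 1 = n → U.d n m w = t.f m (sphereEquiv R m 1)) ∧
        p.f n w = b.f n (discEquiv R (fun _ => R) n (1, 0)) := by
      obtain ⟨w, hw⟩ := hw n (n - 1) (by lia)
      refine ⟨w, fun m hm => ?_, hw.2⟩
      obtain rfl : m = n - 1 := by lia
      exact hw.1
    choose w hw₁ hw₂ using hw'
    refine ⟨⟨⟨discDesc fun n => LinearMap.toSpanSingleton R _ (w n), ?_, ?_⟩⟩⟩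
    · refine sphereSum_hom_ext fun n => ?_
      change (discDesc fun n => LinearMap.toSpanSingleton R _ (w n)).f n
        ((sphereSumToDisc R).f n (sphereEquiv R n 1)) = _
      rw [sphereSumToDisc_f_apply, discDesc_f_apply]
      simpa using hw₁ (n + 1) n rfl
    · refine discComplex_hom_ext fun n a => ?_
      change p.f n ((discDesc fun n => LinearMap.toSpanSingleton R _ (w n)).f n
        (discEquiv R (fun _ => R) n (a, 0))) = _
      rw [discDesc_f_apply]
      have : (a, (0 : R)) = a • (1, 0) := by simp
      simp only [LinearMap.toSpanSingleton_apply, map_zero, add_zero]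
      rw [this, map_smul, map_smul, map_smul, hw₂]

theorem isTrivialFibration_of_hasLiftingProperty {U V : ChainComplex (ModuleCat.{u} R) ℤ}
    {p : U ⟶ V} [HasLiftingProperty (sphereSumToDisc R) p] : IsTrivialFibration p := by
  rintro _ _ k rfl rfl x v hx hv
  let z : ∀ n, U.X n := Pi.single (k + 1) x
  let y : ∀ n, V.X n := Pi.single (k + 1 + 1) v
  have hz : z (k + 1) = x := Pi.single_eq_same _ _
  have hy : y (k + 1 + 1) = v := Pi.single_eq_same _ _
  have hz' (n : ℤ) (hn : n ≠ k + 1) : z n = 0 := Pi.single_eq_of_ne hn _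
  have hy' (n : ℤ) (hn : n ≠ k + 1 + 1) : y n = 0 := Pi.single_eq_of_ne hn _
  have hzd (n : ℤ) : U.d (n + 1) n (z (n + 1)) = 0 := by
    by_cases hn : n = k
    · subst hn
      rw [hz, hx]
    · rw [hz' _ (by lia), map_zero]
  have hzy (n : ℤ) : p.f n (z n) = V.d (n + 1) n (y (n + 1)) := by
    by_cases hn : n = k + 1
    · subst hn
      rw [hz, hy, hv]
    · rw [hz' _ hn, hy' _ (by lia), map_zero, map_zero]
  let t : sphereSum R ⟶ U := chainMapOfLinear
    (fun n => LinearMap.toSpanSingleton R _ (z n) ∘ₗ (sphereEquiv R n).symm.toLinearMap)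
    (fun n r => by
      rw [sphereSum_d]
      refine (map_zero (LinearMap.toSpanSingleton R _ (z n) ∘ₗ
        (sphereEquiv R n).symm.toLinearMap)).trans ?_
      simp [hzd])
  have ht (n : ℤ) : t.f n (sphereEquiv R n 1) = z n := one_smul R (z n)
  let b : (discComplex (R := R) fun _ => R) ⟶ V :=
    discDesc fun n => LinearMap.toSpanSingleton R _ (y n)
  have hb (n : ℤ) (r : R × R) : b.f n (discEquiv R (fun _ => R) n r) =
      r.1 • y n + V.d (n + 1) n (r.2 • y (n + 1)) := rfl
  have sq : CommSq t (sphereSumToDisc R) p b := ⟨sphereSum_hom_ext fun n => by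
    change p.f n (t.f n (sphereEquiv R n 1)) = b.f n ((sphereSumToDisc R).f n (sphereEquiv R n 1))
    rw [ht, sphereSumToDisc_f_apply, hb, hzy]
    simp⟩
  have hl (n : ℤ) (r) : sq.lift.f n ((sphereSumToDisc R).f n r) = t.f n r :=
    congr_f_apply sq.fac_left n r
  have hr (n : ℤ) (r) : p.f n (sq.lift.f n r) = b.f n r :=
    congr_f_apply sq.fac_right n r
  refine ⟨sq.lift.f (k + 1 + 1) (discEquiv R (fun _ => R) _ (1, 0)), ?_, ?_⟩
  · rw [← hom_f_d_apply, discComplex_d_apply, ← sphereSumToDisc_f_apply, hl, ht, hz]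
  · rw [hr, hb, ← hy]
    simp

instance : Mono (sphereSumToDisc R) := by
  have (n : ℤ) : Mono ((sphereSumToDisc R).f n) := by
    rw [ModuleCat.mono_iff_injective]
    intro x y hxy
    exact congrArg Prod.snd ((discEquiv R (fun _ => R) n).injective hxy)
  exact HomologicalComplex.mono_of_mono_f _ this

open MorphismProperty in
instance : HasSmallObjectArgument.{u}
    (MorphismProperty.ofHoms fun _ : PUnit.{u + 1} => sphereSumToDisc R) := by
  obtain ⟨κ, hκ', hκ⟩ := HasCardinalLT.exists_regular_cardinal.{u} (Subobject (sphereSum R))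
  have : Fact κ.IsRegular := ⟨hκ'⟩
  have : Nonempty κ.ord.ToType := by simpa using hκ'.ne_zero
  have := WellFoundedLT.toOrderBot κ.ord.ToType
  exact ⟨κ, inferInstance, inferInstance,
    { preservesColimit {A B X Y} i hi f hf := by
        let hf' : (monomorphisms (ChainComplex (ModuleCat.{u} R) ℤ)).TransfiniteCompositionOfShape
            κ.ord.ToType f :=
          { toTransfiniteCompositionOfShape := hf.toTransfiniteCompositionOfShape
            map_mem j hj := by
              have := (hf.attachCells j hj).pushouts_coproducts
              simp only [ofHoms_homFamily] at this
              refine (pushouts_le_iff.2 (coproducts_le_iff.2 ?_) :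
                _ ≤ monomorphisms (ChainComplex (ModuleCat.{u} R) ℤ)) _ this
              rintro _ _ _ ⟨⟩
              exact monomorphisms.infer_property _ }
        have (j j' : κ.ord.ToType) (φ : j ⟶ j') : Mono (hf'.F.map φ) := hf'.mem_map φ
        obtain ⟨⟩ := hi
        exact IsGrothendieckAbelian.preservesColimit_coyoneda_obj_of_mono (Y := hf'.F) hκ }⟩

/-- Every complex maps to an exact complex by a chain map that lifts against all trivial
fibrations. -/
theorem exists_acyclic_approximation (X : ChainComplex (ModuleCat.{u} R) ℤ) :
    ∃ (T : ChainComplex (ModuleCat.{u} R) ℤ) (ι : X ⟶ T), T.Acyclic ∧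
      ∀ ⦃U V : ChainComplex (ModuleCat.{u} R) ℤ⦄ (p : U ⟶ V), IsTrivialFibration p →
        HasLiftingProperty ι p := by
  let I := MorphismProperty.ofHoms fun _ : PUnit.{u + 1} => sphereSumToDisc R
  have hI {U V : ChainComplex (ModuleCat.{u} R) ℤ} (p : U ⟶ V) :
      I.rlp p ↔ IsTrivialFibration p := by
    refine ⟨fun h => ?_, fun h _ _ _ hi => ?_⟩
    · have := h _ (.mk PUnit.unit)
      exact isTrivialFibration_of_hasLiftingProperty
    · obtain ⟨⟩ := hi
      exact h.hasLiftingProperty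
  let D := MorphismProperty.factorizationData I.rlp.llp I.rlp
    (0 : X ⟶ HomologicalComplex.zero)
  exact ⟨D.Z, D.i, acyclic_of_isTrivialFibration HomologicalComplex.isZero_zero ((hI _).1 D.hp),
    fun U V p hp => D.hi _ ((hI p).2 hp)⟩

end DiscComplexes

/-! ### Exact complexes with flat cycles lie in the left class -/

section FlatComplexes

variable {R : Type u} [Ring R]

theorem HasInjectiveDual.exists_lift_kernel_of_free {Z H G : Type u} [AddCommGroup Z] [Module R Z]
    [AddCommGroup H] [Module R H] [AddCommGroup G] [Module R G] [Module.Free R G]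
    (hZ : HasInjectiveDual R Z) {q : H →ₗ[R] Z} (hq : Function.Surjective q) (σ : G →ₗ[R] Z)
    (x : G) (hx : σ x = 0) : ∃ v : G →ₗ[R] H, (∀ y, q (v y) = σ y) ∧ v x = 0 := by
  let e := (Module.Free.chooseBasis R G).repr
  -- Then make up for the difference in degree `n` by boundaries, again so that the given element of
  -- the kernel is respected; in degree `n + 1`, the lift `w` gives a map over `K`.
  obtain ⟨v, hv, hvx⟩ := hZ.exists_lift_kernel hq (σ ∘ₗ e.symm.toLinearMap) (e x) (by simpa)
  refine ⟨v ∘ₗ e.toLinearMap, fun y => ?_, hvx⟩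
  simpa using DFunLike.congr_fun hv (e y)

variable (K : ChainComplex (ModuleCat.{u} R) ℤ)

/-- The free module on countably many copies of each element of `K_n`. -/
abbrev coverBasisModule (n : ℤ) : Type u := (K.X n × ℕ) →₀ R

/-- The projection of the free module on copies of the elements of `K_n` to `K_n`. -/
noncomputable def coverMap (n : ℤ) : coverBasisModule K n →ₗ[R] K.X n :=
  Finsupp.linearCombination R Prod.fst

theorem coverMap_single (n : ℤ) (b : K.X n × ℕ) : coverMap K n (Finsupp.single b 1) = b.1 := by
  simp [coverMap]

theorem coverMap_surjective (n : ℤ) : Function.Surjective (coverMap K n) :=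
  fun x => ⟨Finsupp.single (x, 0) 1, coverMap_single K n _⟩

/-- A free contractible complex that maps onto `K`. Each element of `K` is hit by countably many
basis elements, so that there is always room for a finite set of new basis elements. -/
noncomputable abbrev freeCover : ChainComplex (ModuleCat.{u} R) ℤ :=
  freeDisc R fun n => K.X n × ℕ

/-- The projection of the free cover of `K`. -/
noncomputable def freeCoverπ : freeCover K ⟶ K :=
  discDesc (coverMap K)

theorem freeCoverπ_f_apply (n : ℤ) (x : coverBasisModule K n × coverBasisModule K (n + 1)) :
    (freeCoverπ K).f n (discEquiv R (coverBasisModule K) n x) =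
      coverMap K n x.1 + K.d (n + 1) n (coverMap K (n + 1) x.2) := rfl

theorem freeCoverπ_f_gen (n : ℤ) (b : K.X n × ℕ) :
    (freeCoverπ K).f n (freeDiscGen R n b) = b.1 := by
  rw [freeDiscGen, freeCoverπ_f_apply]
  simp [coverMap_single]

theorem freeCoverπ_f_surjective (n : ℤ) : Function.Surjective ((freeCoverπ K).f n) := fun x => by
  obtain ⟨y, rfl⟩ := coverMap_surjective K n x
  exact ⟨discEquiv R (coverBasisModule K) n (y, 0), by rw [freeCoverπ_f_apply]; simp⟩

/-- The differential `K_i → K_j`, with values in the cycles. -/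
def dToCycles (i j k : ℤ) : K.X i →ₗ[R] LinearMap.ker (K.d j k).hom :=
  LinearMap.codRestrict _ (K.d i j).hom fun x => d_apply_d_apply K i j k x

variable {K}

theorem dToCycles_surjective (hK : K.Acyclic) {i j k : ℤ} (hi : j + 1 = i) (hk : k + 1 = j) :
    Function.Surjective (dToCycles K i j k) := fun x => by
  obtain ⟨y, hy⟩ := (acyclic_iff_exists K).1 hK i j k hi hk x.1 x.2
  exact ⟨y, Subtype.ext hy⟩

/-- The cycles of `K` being flat, each element of the kernel of the free cover is killed by an
endomorphism of the free cover over `K`. -/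
theorem exists_endomorphism_kill_one (hK : K.Acyclic)
    (hZ : ∀ j k : ℤ, k + 1 = j → HasInjectiveDual R (LinearMap.ker (K.d j k).hom)) (n : ℤ)
    (x : (freeCover K).X n) (hx : (freeCoverπ K).f n x = 0) :
    ∃ e : freeCover K ⟶ freeCover K, e ≫ freeCoverπ K = freeCoverπ K ∧ e.f n x = 0 := by
  obtain ⟨⟨a, b⟩, rfl⟩ := (discEquiv R (coverBasisModule K) n).surjective x
  rw [freeCoverπ_f_apply] at hx
  let D (i j k : ℤ) : coverBasisModule K i →ₗ[R] LinearMap.ker (K.d j k).hom :=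
    dToCycles K i j k ∘ₗ coverMap K i
  have hD {i j k : ℤ} (hi : j + 1 = i) (hk : k + 1 = j) : Function.Surjective (D i j k) :=
    (dToCycles_surjective hK hi hk).comp (coverMap_surjective K i)
  have hDa : D n (n - 1) (n - 2) a = 0 := by
    refine Subtype.ext ?_
    change K.d n (n - 1) (coverMap K n a) = 0
    rw [eq_neg_of_add_eq_zero_left hx, map_neg, d_apply_d_apply, neg_zero]
  -- First make the boundary of the image of each basis element factor through a relation that `a`
  -- satisfies formally.
  obtain ⟨u, hu, hua⟩ := (hZ (n - 1) (n - 2) (by lia)).exists_lift_kernel_of_free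
    (hD (i := n) (by lia) (by lia)) (D n (n - 1) (n - 2)) a hDa
  have hu' (y) : K.d n (n - 1) (coverMap K n (u y)) = K.d n (n - 1) (coverMap K n y) :=
    congrArg Subtype.val (hu y)
  let σ : coverBasisModule K n × coverBasisModule K (n + 1) →ₗ[R]
      LinearMap.ker (K.d n (n - 1)).hom :=
    LinearMap.codRestrict _ (LinearMap.coprod (coverMap K n ∘ₗ (LinearMap.id - u))
      ((K.d (n + 1) n).hom ∘ₗ coverMap K (n + 1))) fun y => by
        change K.d n (n - 1) (coverMap K n (y.1 - u y.1) +
          K.d (n + 1) n (coverMap K (n + 1) y.2)) = 0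
        rw [map_add, d_apply_d_apply, map_sub, map_sub, hu', sub_self, zero_add]
  obtain ⟨v, hv, hvx⟩ := (hZ n (n - 1) (by lia)).exists_lift_kernel_of_free
    (hD (i := n + 1) rfl (by lia)) σ (a, b) (Subtype.ext (by
      change coverMap K n (a - u a) + K.d (n + 1) n (coverMap K (n + 1) b) = 0
      rw [hua, sub_zero]
      exact hx))
  have hv' (y) : K.d (n + 1) n (coverMap K (n + 1) (v y)) =
      coverMap K n (y.1 - u y.1) + K.d (n + 1) n (coverMap K (n + 1) y.2) :=
    congrArg Subtype.val (hv y)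
  let τ : coverBasisModule K (n + 1) →ₗ[R] LinearMap.ker (K.d (n + 1) n).hom :=
    LinearMap.codRestrict _ (coverMap K (n + 1) ∘ₗ (LinearMap.id - v ∘ₗ LinearMap.inr R _ _))
      fun y => by
        change K.d (n + 1) n (coverMap K (n + 1) (y - v (0, y))) = 0
        rw [map_sub, map_sub, hv']
        simp
  obtain ⟨w, hw⟩ := Module.projective_lifting_property (D (n + 1 + 1) (n + 1) n) τ (hD rfl rfl)
  have hw' (y) : K.d (n + 1 + 1) (n + 1) (coverMap K (n + 1 + 1) (w y)) =
      coverMap K (n + 1) (y - v (0, y)) := congrArg Subtype.val (DFunLike.congr_fun hw y)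
  let E (m : ℤ) := discEquiv R (coverBasisModule K) m
  let φ : ∀ m, coverBasisModule K m →ₗ[R] (freeCover K).X m :=
    Function.update (Function.update (fun m => (E m).toLinearMap ∘ₗ LinearMap.inl R _ _) n
      ((E n).toLinearMap ∘ₗ LinearMap.prod u (v ∘ₗ LinearMap.inl R _ _))) (n + 1)
      ((E (n + 1)).toLinearMap ∘ₗ LinearMap.prod (v ∘ₗ LinearMap.inr R _ _) w)
  have hφ₁' : φ (n + 1) = (E (n + 1)).toLinearMap ∘ₗ LinearMap.prod (v ∘ₗ LinearMap.inr R _ _) w :=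
    Function.update_self _ _ _
  have hφ₀' : φ n = (E n).toLinearMap ∘ₗ LinearMap.prod u (v ∘ₗ LinearMap.inl R _ _) :=
    (Function.update_of_ne (by lia) _ _).trans (Function.update_self _ _ _)
  have hφ' (m) (h₀ : m ≠ n) (h₁ : m ≠ n + 1) : φ m = (E m).toLinearMap ∘ₗ LinearMap.inl R _ _ :=
    (Function.update_of_ne h₁ _ _).trans (Function.update_of_ne h₀ _ _)
  have hφ₁ (y) : φ (n + 1) y = E (n + 1) (v (0, y), w y) :=
    DFunLike.congr_fun hφ₁' y
  have hφ₀ (y) : φ n y = E n (u y, v (y, 0)) :=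
    DFunLike.congr_fun hφ₀' y
  have hφ (m) (h₀ : m ≠ n) (h₁ : m ≠ n + 1) (y) : φ m y = E m (y, 0) :=
    DFunLike.congr_fun (hφ' m h₀ h₁) y
  refine ⟨discDesc φ, discComplex_hom_ext fun m y => ?_, ?_⟩
  · change (freeCoverπ K).f m ((discDesc φ).f m (E m (y, 0))) = (freeCoverπ K).f m (E m (y, 0))
    rw [discDesc_f_apply]
    simp only [map_zero, add_zero]
    by_cases h₀ : m = n
    · subst h₀
      rw [hφ₀, freeCoverπ_f_apply, freeCoverπ_f_apply]
      simp [hv']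
    by_cases h₁ : m = n + 1
    · subst h₁
      rw [hφ₁, freeCoverπ_f_apply, freeCoverπ_f_apply]
      simp [hw']
    · rw [hφ m h₀ h₁]
  · rw [discDesc_f_apply, hφ₀, hφ₁, discComplex_d_apply]
    rw [← map_add]
    simp only [hua, Prod.mk_add_mk, add_zero, ← map_add, zero_add]
    rw [hvx]
    exact map_zero (E n)

theorem exists_endomorphism_kill (hK : K.Acyclic)
    (hZ : ∀ j k : ℤ, k + 1 = j → HasInjectiveDual R (LinearMap.ker (K.d j k).hom))
    (s : Finset (Σ n, (freeCover K).X n)) (hs : ∀ x ∈ s, (freeCoverπ K).f x.1 x.2 = 0) :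
    ∃ e : freeCover K ⟶ freeCover K, e ≫ freeCoverπ K = freeCoverπ K ∧
      ∀ x ∈ s, e.f x.1 x.2 = 0 := by
  classical
  induction s using Finset.induction_on with
  | empty => exact ⟨𝟙 _, Category.id_comp _, by simp⟩
  | insert x s _ ih =>
    obtain ⟨e, he, hes⟩ := ih fun y hy => hs y (Finset.mem_insert_of_mem hy)
    have hex : (freeCoverπ K).f x.1 (e.f x.1 x.2) = 0 :=
      (congr_f_apply he x.1 x.2).trans (hs x (Finset.mem_insert_self _ _))
    obtain ⟨e', he', hex'⟩ := exists_endomorphism_kill_one hK hZ x.1 _ hex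
    refine ⟨e ≫ e', by rw [Category.assoc, he', he], fun y hy => ?_⟩
    change e'.f y.1 (e.f y.1 y.2) = 0
    rcases Finset.mem_insert.1 hy with rfl | hy
    · exact hex'
    · rw [hes y hy, map_zero]

variable (K) in
/-- The free contractible complex on a finite set of basis elements of the free cover. -/
noncomputable abbrev finiteFree (A : Finset (Σ n, K.X n × ℕ)) : ChainComplex (ModuleCat.{u} R) ℤ :=
  freeDisc R fun n => {b : K.X n × ℕ // (⟨n, b⟩ : Σ n, K.X n × ℕ) ∈ A}

/-- Finitely many elements of the kernel of the free cover lie in a finitely generated subcomplex of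
the kernel which is projective: if `e` kills these elements and `A` contains their supports, then
the subcomplex is the image of `1 - τ ∘ e` on the span of `A`, where `τ` moves the basis to copies
away from `A`. -/
theorem exists_projective_subcomplex (hK : K.Acyclic)
    (hZ : ∀ j k : ℤ, k + 1 = j → HasInjectiveDual R (LinearMap.ker (K.d j k).hom))
    (s : Finset (Σ n, (freeCover K).X n)) (hs : ∀ x ∈ s, (freeCoverπ K).f x.1 x.2 = 0) :
    ∃ (A : Finset (Σ n, K.X n × ℕ)) (a : finiteFree K A ⟶ freeCover K), Mono a ∧
      a ≫ freeCoverπ K = 0 ∧ ∀ x ∈ s, ∃ y, a.f x.1 y = x.2 := by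
  classical
  obtain ⟨e, he, hes⟩ := exists_endomorphism_kill hK hZ s hs
  let E (n : ℤ) := discEquiv R (coverBasisModule K) n
  let A : Finset (Σ n, K.X n × ℕ) := s.biUnion fun x =>
    ((E x.1).symm x.2).1.support.image (fun b => ⟨x.1, b⟩) ∪
      ((E x.1).symm x.2).2.support.image (fun b => ⟨x.1 + 1, b⟩)
  let N : ℕ := A.sup (fun b => b.2.2) + 1
  have hN (n : ℤ) (b : K.X n × ℕ) : (⟨n, (b.1, b.2 + N)⟩ : Σ n, K.X n × ℕ) ∉ A := fun hb => by
    have : b.2 + N ≤ A.sup (fun b => b.2.2) := Finset.le_sup (f := fun b => b.2.2) hb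
    lia
  let i : finiteFree K A ⟶ freeCover K := freeDiscDesc fun n b => freeDiscGen R n b.1
  let r : freeCover K ⟶ finiteFree K A := freeDiscDesc fun n b =>
    if h : (⟨n, b⟩ : Σ n, K.X n × ℕ) ∈ A then freeDiscGen R n ⟨b, h⟩ else 0
  let τ : freeCover K ⟶ freeCover K := freeDiscDesc fun n b => freeDiscGen R n (b.1, b.2 + N)
  have hir : i ≫ r = 𝟙 _ := freeDisc_hom_ext fun n b => by
    rw [comp_f_apply, freeDiscDesc_f_gen, freeDiscDesc_f_gen, dif_pos b.2]
    rfl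
  have hτr : τ ≫ r = 0 := freeDisc_hom_ext fun n b => by
    rw [comp_f_apply, freeDiscDesc_f_gen, freeDiscDesc_f_gen, dif_neg (hN n b)]
    rfl
  have hτπ : τ ≫ freeCoverπ K = freeCoverπ K := freeDisc_hom_ext fun n b => by
    rw [comp_f_apply, freeDiscDesc_f_gen, freeCoverπ_f_gen, freeCoverπ_f_gen]
  have hri (n : ℤ) (c : coverBasisModule K n)
      (hc : ∀ b ∈ c.support, (⟨n, b⟩ : Σ n, K.X n × ℕ) ∈ A) :
      i.f n (r.f n (E n (c, 0))) = E n (c, 0) := by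
    refine freeDisc_hom_apply_eq (r ≫ i) (𝟙 _) n c fun b hb => ?_
    rw [comp_f_apply, freeDiscDesc_f_gen, dif_pos (hc b hb), freeDiscDesc_f_gen]
    rfl
  have hri' (x) (hx : x ∈ s) : i.f x.1 (r.f x.1 x.2) = x.2 := by
    obtain ⟨n, x⟩ := x
    obtain ⟨⟨c, c'⟩, rfl⟩ := (E n).surjective x
    have h₁ : i.f n (r.f n (E n (c, 0))) = E n (c, 0) := hri n c fun b hb =>
      Finset.mem_biUnion.2 ⟨_, hx, Finset.mem_union_left _ (Finset.mem_image.2 ⟨b, hb, rfl⟩)⟩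
    have h₂ : i.f (n + 1) (r.f (n + 1) (E (n + 1) (c', 0))) = E (n + 1) (c', 0) :=
      hri (n + 1) c' fun b hb => Finset.mem_biUnion.2
        ⟨_, hx, Finset.mem_union_right _ (Finset.mem_image.2 ⟨b, hb, rfl⟩)⟩
    have h₃ := discComplex_hom_apply (r ≫ i) n (c, c')
    rw [comp_f_apply, comp_f_apply, comp_f_apply, h₁, h₂, discComplex_d_apply, ← map_add] at h₃
    simpa using h₃
  refine ⟨A, i - i ≫ e ≫ τ, ?_, ?_, fun x hx => ⟨r.f x.1 x.2, ?_⟩⟩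
  · have : (i - i ≫ e ≫ τ) ≫ r = 𝟙 _ := by
      simp [Preadditive.sub_comp, hir, hτr]
    exact mono_of_mono_fac this
  · simp [Preadditive.sub_comp, he, hτπ]
  · change i.f x.1 (r.f x.1 x.2) - τ.f x.1 (e.f x.1 (i.f x.1 (r.f x.1 x.2))) = x.2
    rw [hri' x hx, hes x hx, map_zero, sub_zero]

variable {W F : ObjectProperty (ChainComplex (ModuleCat.{u} R) ℤ)}

/-- Exact complexes with flat cycles lie in the left class of every injective cotorsion pair. -/
theorem IsInjectiveCotorsionPair.mem_of_acyclic_of_flat_cycles (h : IsInjectiveCotorsionPair W F)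
    (hK : K.Acyclic)
    (hZ : ∀ j k : ℤ, k + 1 = j → HasInjectiveDual R (LinearMap.ker (K.d j k).hom)) : W K := by
  classical
  have hproj (P : ChainComplex (ModuleCat.{u} R) ℤ) [Projective P] : W P :=
    (h.cotorsionPair.left_iff P).2 fun B _ =>
      subsingleton_of_forall_eq 0 fun x => Ext.eq_zero_of_projective x
  let J := Σ A : Finset (Σ n, K.X n × ℕ),
    {a : finiteFree K A ⟶ freeCover K // Mono a ∧ a ≫ freeCoverπ K = 0}
  have hmono (j : J) : Mono j.2.1 := j.2.2.1
  let S (j : J) : Subobject (freeCover K) := Subobject.mk j.2.1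
  have hS (j : J) : W (S j : ChainComplex (ModuleCat.{u} R) ℤ) := by
    have := Projective.of_iso (Subobject.underlyingIso j.2.1).symm inferInstance
    exact hproj _
  obtain ⟨A₀, a₀, h₀, h₀', _⟩ := exists_projective_subcomplex hK hZ ∅ (by simp)
  have : Nonempty J := ⟨⟨A₀, a₀, h₀, h₀'⟩⟩
  -- The images of the basis elements.
  let gen (j : J) : Finset (Σ n, (freeCover K).X n) := j.1.attach.image fun b =>
    ⟨b.1.1, j.2.1.f b.1.1 (freeDiscGen R b.1.1 ⟨b.1.2, b.2⟩)⟩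
  have hgen (j : J) : ∀ x ∈ gen j, (freeCoverπ K).f x.1 x.2 = 0 := by
    intro x hx
    obtain ⟨b, _, rfl⟩ := Finset.mem_image.1 hx
    exact congr_f_apply j.2.2.2 b.1.1 _
  have hle {j j' : J} (hjj' : ∀ x ∈ gen j, ∃ y, j'.2.1.f x.1 y = x.2) : S j ≤ S j' := by
    have hex (n : ℤ) (b : {b : K.X n × ℕ // (⟨n, b⟩ : Σ n, K.X n × ℕ) ∈ j.1}) :=
      hjj' _ (Finset.mem_image_of_mem _ (Finset.mem_attach _ ⟨⟨n, b.1⟩, b.2⟩))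
    choose l hl using hex
    exact Subobject.mk_le_mk_of_comm (freeDiscDesc l) (freeDisc_hom_ext fun n b => by
      rw [comp_f_apply, freeDiscDesc_f_gen, hl])
  have hdir : Directed (· ≤ ·) S := fun j j' => by
    obtain ⟨A, a, ha, ha', hs⟩ := exists_projective_subcomplex hK hZ (gen j ∪ gen j')
      fun x hx => (Finset.mem_union.1 hx).elim (hgen j x) (hgen j' x)
    exact ⟨⟨A, a, ha, ha'⟩, hle fun x hx => hs x (Finset.mem_union_left _ hx),
      hle fun x hx => hs x (Finset.mem_union_right _ hx)⟩
  have hT := h.iSup_directed_mem hdir hS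
  have hzero : (⨆ j, S j).arrow ≫ freeCoverπ K = 0 := by
    have hker : ⨆ j, S j ≤ kernelSubobject (freeCoverπ K) := iSup_le fun j =>
      le_kernelSubobject _ _ (by
        rw [← cancel_epi (Subobject.underlyingIso j.2.1).inv]
        simp [S, j.2.2.2])
    rw [← Subobject.ofLE_arrow hker, Category.assoc, kernelSubobject_arrow_comp, comp_zero]
  refine h.thick.right (ShortComplex.mk (⨆ j, S j).arrow (freeCoverπ K) hzero) ?_ hT (hproj _)
  refine HomologicalComplex.shortExact_of_degreewise_shortExact _ fun n =>
    { exact := ?_, mono_f := ?_, epi_g := ?_ }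
  · refine (ShortComplex.moduleCat_exact_iff _).2 fun x hx => ?_
    obtain ⟨A, a, ha, ha', hs⟩ := exists_projective_subcomplex hK hZ {⟨n, x⟩}
      (fun y hy => by obtain rfl := Finset.mem_singleton.1 hy; exact hx)
    obtain ⟨y, hy⟩ := hs ⟨n, x⟩ (by simp)
    let j : J := ⟨A, a, ha, ha'⟩
    refine ⟨((Subobject.underlyingIso a).inv ≫ Subobject.ofLE _ _ (le_iSup S j)).f n y, ?_⟩
    have : ((Subobject.underlyingIso a).inv ≫ Subobject.ofLE _ _ (le_iSup S j)) ≫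
        (⨆ j, S j).arrow = a := by
      rw [Category.assoc, Subobject.ofLE_arrow]
      exact Subobject.underlyingIso_arrow a
    refine Eq.trans ?_ hy
    exact congr_f_apply this n y
  · exact inferInstanceAs (Mono ((HomologicalComplex.eval _ _ n).map (⨆ j, S j).arrow))
  · exact (ModuleCat.epi_iff_surjective _).2 (freeCoverπ_f_surjective K n)

end FlatComplexes

/-! ### Character complexes and null-homotopies -/

section DualComplexes

variable {R : Type u} [Ring R]

section Maps

variable {M N : Type u} [AddCommGroup M] [Module R M] [AddCommGroup N] [Module R N]
variable {A B : Type u} [AddCommGroup A] [Module Rᵐᵒᵖ A] [AddCommGroup B] [Module Rᵐᵒᵖ B]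

/-- The transpose of a homomorphism of left modules. -/
def rightDualMap (f : M →ₗ[R] N) : CharacterModule N →ₗ[Rᵐᵒᵖ] CharacterModule M where
  toFun χ := AddMonoidHom.comp χ f.toAddMonoidHom
  map_add' _ _ := rfl
  map_smul' r χ := CharacterModule.ext _ fun m => congrArg χ (f.map_smul r.unop m).symm

/-- The transpose of a homomorphism of right modules. -/
def leftDualMap (f : A →ₗ[Rᵐᵒᵖ] B) : CharacterModule B →ₗ[R] CharacterModule A where
  toFun ξ := AddMonoidHom.comp ξ f.toAddMonoidHom
  map_add' _ _ := rfl
  map_smul' r ξ := CharacterModule.ext _ fun a => congrArg ξ (f.map_smul (MulOpposite.op r) a).symm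

theorem rightDualMap_zero : rightDualMap (0 : M →ₗ[R] N) = 0 :=
  LinearMap.ext fun χ => CharacterModule.ext _ fun _ => map_zero χ

theorem leftDualMap_zero : leftDualMap (0 : A →ₗ[Rᵐᵒᵖ] B) = 0 :=
  LinearMap.ext fun ξ => CharacterModule.ext _ fun _ => map_zero ξ

theorem rightDualMap_comp_eq_zero {L : Type u} [AddCommGroup L] [Module R L] {f : M →ₗ[R] N}
    {g : N →ₗ[R] L} (h : ∀ m, g (f m) = 0) : rightDualMap f ∘ₗ rightDualMap g = 0 :=
  LinearMap.ext fun χ => CharacterModule.ext _ fun m => (congrArg χ (h m)).trans (map_zero χ)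

theorem leftDualMap_comp_eq_zero {C : Type u} [AddCommGroup C] [Module Rᵐᵒᵖ C]
    {f : A →ₗ[Rᵐᵒᵖ] B} {g : B →ₗ[Rᵐᵒᵖ] C} (h : ∀ a, g (f a) = 0) :
    leftDualMap f ∘ₗ leftDualMap g = 0 :=
  LinearMap.ext fun ξ => CharacterModule.ext _ fun a => (congrArg ξ (h a)).trans (map_zero ξ)

theorem leftDualMap_surjective {f : A →ₗ[Rᵐᵒᵖ] B} (hf : Function.Injective f) :
    Function.Surjective (leftDualMap f) := fun ξ => by
  obtain ⟨ψ, hψ⟩ := exists_character_extension f.toAddMonoidHom ξ fun a ha => by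
    rw [hf (ha.trans f.map_zero.symm), map_zero]
  exact ⟨ψ, CharacterModule.ext _ hψ⟩

variable (R M) in
/-- The canonical homomorphism from a module to its double character module. -/
def bidualUnit : M →ₗ[R] CharacterModule (CharacterModule M) where
  toFun m := AddMonoidHom.mk' (fun χ : CharacterModule M => χ m) fun _ _ => rfl
  map_add' m m' := CharacterModule.ext _ fun χ => map_add χ m m'
  map_smul' _ _ := rfl

end Maps

/-- The complex of character modules of a complex of left modules. The grading is reversed, so that
the result is again a chain complex. -/
def dualComplex (T : ChainComplex (ModuleCat.{u} R) ℤ) : ChainComplex (ModuleCat.{u} Rᵐᵒᵖ) ℤ where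
  X j := ModuleCat.of Rᵐᵒᵖ (CharacterModule (T.X (-j)))
  d i j := ModuleCat.ofHom (rightDualMap (T.d (-j) (-i)).hom)
  shape i j hij := by
    rw [T.shape (-j) (-i) fun h => hij (show j + 1 = i by have : -i + 1 = -j := h; lia)]
    exact ModuleCat.hom_ext rightDualMap_zero
  d_comp_d' i j k _ _ := ModuleCat.hom_ext
    (rightDualMap_comp_eq_zero (d_apply_d_apply T (-k) (-j) (-i)))

/-- The complex of double character modules. -/
def bidualComplex (T : ChainComplex (ModuleCat.{u} R) ℤ) : ChainComplex (ModuleCat.{u} R) ℤ where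
  X n := ModuleCat.of R (CharacterModule (CharacterModule (T.X n)))
  d i j := ModuleCat.ofHom (leftDualMap (rightDualMap (T.d i j).hom))
  shape i j hij := by
    rw [T.shape i j hij]
    exact ModuleCat.hom_ext ((congrArg leftDualMap rightDualMap_zero).trans leftDualMap_zero)
  d_comp_d' i j k _ _ := ModuleCat.hom_ext (leftDualMap_comp_eq_zero fun χ =>
    DFunLike.congr_fun (rightDualMap_comp_eq_zero (d_apply_d_apply T i j k)) χ)

variable {T : ChainComplex (ModuleCat.{u} R) ℤ}

theorem exists_rightDualMap_eq (hT : T.Acyclic) {i j k : ℤ} (hi : j + 1 = i) (hk : k + 1 = j)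
    (χ : CharacterModule (T.X j)) (hχ : rightDualMap (T.d i j).hom χ = 0) :
    ∃ ψ : CharacterModule (T.X k), rightDualMap (T.d j k).hom ψ = χ := by
  obtain ⟨ψ, hψ⟩ := exists_character_extension (T.d j k).hom.toAddMonoidHom χ fun x hx => by
    obtain ⟨y, rfl⟩ := (acyclic_iff_exists T).1 hT i j k hi hk x hx
    exact DFunLike.congr_fun hχ y
  exact ⟨ψ, CharacterModule.ext _ hψ⟩

theorem dualComplex_acyclic (hT : T.Acyclic) : (dualComplex T).Acyclic := by
  rw [acyclic_iff_exists]
  intro i j k hi hk χ hχ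
  exact exists_rightDualMap_eq hT (by lia) (by lia) χ hχ

theorem bidualComplex_acyclic (hT : T.Acyclic) : (bidualComplex T).Acyclic := by
  rw [acyclic_iff_exists]
  intro i j k hi hk (ξ : CharacterModule (CharacterModule (T.X j))) hξ
  obtain ⟨ψ, hψ⟩ := exists_character_extension (rightDualMap (T.d i j).hom).toAddMonoidHom ξ
    fun χ hχ => by
      obtain ⟨φ, rfl⟩ := exists_rightDualMap_eq hT hi hk χ hχ
      exact DFunLike.congr_fun (F := CharacterModule (CharacterModule (T.X k))) hξ φ
  exact ⟨ψ, CharacterModule.ext _ hψ⟩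

variable (T) in
/-- The canonical chain map from a complex to the complex of its double character modules. -/
def toBidualComplex : T ⟶ bidualComplex T :=
  chainMapOfLinear (fun n => bidualUnit R (T.X n)) fun _ _ => rfl

variable {X : ChainComplex (ModuleCat.{u} R) ℤ}

/-- The composite of `ι` with the canonical map from `T` to its double character complex is
null-homotopic, with the homotopy written out. -/
def IsBidualNullHomotopic (ι : X ⟶ T) : Prop :=
  ∃ s : ∀ i j : ℤ, i + 1 = j → X.X i →ₗ[R] CharacterModule (CharacterModule (T.X j)),
    ∀ (i j k : ℤ) (hj : j + 1 = i) (hk : k + 1 = j) (x : X.X j) (χ : CharacterModule (T.X j)),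
      χ (ι.f j x) = s j i hj x (rightDualMap (T.d i j).hom χ) + s k j hk (X.d j k x) χ

variable (X) in
/-- This is the consequence of DG-flatness that the argument uses: the terms of the complex of
character modules of `X` are injective, and every chain map from the character complex of an exact
complex `T` to the character complex of `X` which is the transpose of a chain map `X ⟶ T` is
null-homotopic. -/
structure HasDGInjectiveDual : Prop where
  hasInjectiveDual (n : ℤ) : HasInjectiveDual R (X.X n)
  isBidualNullHomotopic (T : ChainComplex (ModuleCat.{u} R) ℤ) (hT : T.Acyclic) (ι : X ⟶ T) :
    IsBidualNullHomotopic ι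

/-- The null-homotopy on `X` extends to `T`, since it is a lift along `discCounit`. On cycles, one
of its two summands vanishes. -/
theorem IsBidualNullHomotopic.exists_contraction {ι : X ⟶ T} (h : IsBidualNullHomotopic ι)
    (hT : T.Acyclic) (hι : ∀ ⦃U V : ChainComplex (ModuleCat.{u} R) ℤ⦄ (p : U ⟶ V),
      IsTrivialFibration p → HasLiftingProperty ι p) {i j k : ℤ} (hi : j + 1 = i) (hk : k + 1 = j) :
    ∃ s : T.X j →ₗ[R] CharacterModule (CharacterModule (T.X i)), ∀ z, T.d j k z = 0 →
      ∀ χ : CharacterModule (T.X j), χ z = s z (rightDualMap (T.d i j).hom χ) := by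
  subst hi hk
  obtain ⟨s, hs⟩ := h
  let s' : ∀ i j : ℤ, i + 1 = j → X.X i →ₗ[R] (bidualComplex T).X j := s
  have sq : CommSq (discLift (M := fun n => (bidualComplex T).X n) s') ι
      (discCounit (bidualComplex T)) (toBidualComplex T) := ⟨by
    ext n x
    refine CharacterModule.ext _ fun χ => ?_
    exact (add_comm _ _).trans (hs (n + 1) n (n - 1) rfl (by lia) x χ).symm⟩
  have := hι _ (isTrivialFibration_discCounit (bidualComplex_acyclic hT))
  let l := sq.lift
  let E (n : ℤ) := discEquiv R (fun n => (bidualComplex T).X n) n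
  refine ⟨LinearMap.snd R _ _ ∘ₗ (E (k + 1)).symm.toLinearMap ∘ₗ (l.f (k + 1)).hom,
    fun z hz χ => ?_⟩
  obtain ⟨⟨a, b⟩, hab⟩ := (E (k + 1)).surjective (l.f (k + 1) z)
  have ha : a = 0 := by
    refine discComplex_d_eq_zero (R := R) (M := fun n => (bidualComplex T).X n) (n := k)
      (x := (a, b)) ?_
    change (discComplex _).d (k + 1) k (E (k + 1) (a, b)) = 0
    rw [hab, ← hom_f_d_apply, hz, map_zero]
  have hl : (discCounit (bidualComplex T)).f (k + 1) (l.f (k + 1) z) =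
      (toBidualComplex T).f (k + 1) z := congr_f_apply sq.fac_right (k + 1) z
  have hb : ((E (k + 1)).symm (l.f (k + 1) z)).2 = b := by
    rw [← hab, LinearEquiv.symm_apply_apply]
  refine Eq.trans ?_ (DFunLike.congr_fun (F := CharacterModule (CharacterModule (T.X (k + 1 + 1))))
    hb.symm _)
  rw [← hab, discCounit_f_apply, ha, zero_add] at hl
  exact (DFunLike.congr_fun (F := CharacterModule (CharacterModule (T.X (k + 1)))) hl χ).symm

/-- The map of disc complexes induced by a homomorphism. -/
def discMap {M N : ℤ → Type u} [∀ n, AddCommGroup (M n)] [∀ n, Module R (M n)]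
    [∀ n, AddCommGroup (N n)] [∀ n, Module R (N n)] (q : ∀ n, M n →ₗ[R] N n) :
    discComplex (R := R) M ⟶ discComplex (R := R) N :=
  discDesc fun n => (discEquiv R N n).toLinearMap ∘ₗ LinearMap.inl R _ _ ∘ₗ q n

theorem discMap_f_apply {M N : ℤ → Type u} [∀ n, AddCommGroup (M n)] [∀ n, Module R (M n)]
    [∀ n, AddCommGroup (N n)] [∀ n, Module R (N n)] (q : ∀ n, M n →ₗ[R] N n) (n : ℤ) (x) :
    (discMap q).f n (discEquiv R M n x) = discEquiv R N n (q n x.1, q (n + 1) x.2) := by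
  rw [discMap, discDesc_f_apply]
  simp only [LinearMap.comp_apply, LinearEquiv.coe_coe, LinearMap.inl_apply]
  rw [discComplex_d_apply, ← map_add]
  simp

/-- Let `A → B` be an injective homomorphism of right modules. A lift of a homomorphism `T_n → A⁺`
along `B⁺ → A⁺` is a lift of `ι` against the map of disc complexes given by `B⁺ → A⁺`. -/
theorem hasInjectiveDual_of_hasLiftingProperty {ι : X ⟶ T}
    (hX : ∀ n, HasInjectiveDual R (X.X n))
    (hι : ∀ ⦃U V : ChainComplex (ModuleCat.{u} R) ℤ⦄ (p : U ⟶ V),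
      IsTrivialFibration p → HasLiftingProperty ι p) (n : ℤ) : HasInjectiveDual R (T.X n) := by
  intro A B _ _ _ _ f hf h
  let h' : ∀ n, T.X n →ₗ[R] CharacterModule A := Function.update (fun _ => 0) n h
  have hh' : h' n = h := Function.update_self _ _ _
  choose g hg using fun n => hX n f hf (h' n ∘ₗ (ι.f n).hom)
  have sq : CommSq (discLift (M := fun _ => CharacterModule B) fun i _ _ => g i) ι
      (discMap fun _ => leftDualMap f)
      (discLift (M := fun _ => CharacterModule A) fun i _ _ => h' i) := ⟨by
    have hg' (i : ℤ) (x : X.X i) : leftDualMap f (g i x) = h' i (ι.f i x) :=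
      CharacterModule.ext _ (hg i x)
    ext i x
    change (discMap fun _ => leftDualMap f).f i
      ((discLift (M := fun _ => CharacterModule B) fun i _ _ => g i).f i x) =
      (discLift (M := fun _ => CharacterModule A) fun i _ _ => h' i).f i (ι.f i x)
    rw [discLift_f_apply, discLift_f_apply, discMap_f_apply]
    simp only [hg', hom_f_d_apply]⟩
  have := hι _ (isTrivialFibration_disc (discMap fun _ => leftDualMap f) (fun _ => leftDualMap f)
    (discMap_f_apply _) fun _ => leftDualMap_surjective hf)
  let E (n : ℤ) := discEquiv R (fun _ => CharacterModule B) n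
  refine ⟨LinearMap.snd R _ _ ∘ₗ (E n).symm.toLinearMap ∘ₗ (sq.lift.f n).hom, fun m a => ?_⟩
  obtain ⟨y, hy⟩ := (E n).surjective (sq.lift.f n m)
  have hl : (discMap fun _ => leftDualMap f).f n (sq.lift.f n m) =
      (discLift (M := fun _ => CharacterModule A) fun i _ _ => h' i).f n m :=
    congr_f_apply sq.fac_right n m
  rw [← hy, discMap_f_apply, discLift_f_apply, hh'] at hl
  have hl₂ : leftDualMap f y.2 = h m :=
    congrArg Prod.snd ((discEquiv R (fun _ => CharacterModule A) n).injective hl)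
  change ((E n).symm (sq.lift.f n m)).2 (f a) = h m a
  rw [← hy, LinearEquiv.symm_apply_apply, ← hl₂]
  rfl

/-- The contraction splits the inclusion of the character module of the cycles in the character
module of the preceding term. -/
theorem hasInjectiveDual_cycles_of_contraction (hT : ∀ n, HasInjectiveDual R (T.X n)) {i j k : ℤ}
    (s : T.X j →ₗ[R] CharacterModule (CharacterModule (T.X i)))
    (hs : ∀ z, T.d j k z = 0 → ∀ χ : CharacterModule (T.X j),
      χ z = s z (rightDualMap (T.d i j).hom χ)) :
    HasInjectiveDual R (LinearMap.ker (T.d j k).hom) := by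
  intro A B _ _ _ _ f hf h
  obtain ⟨g, hg⟩ := hT i f hf (h ∘ₗ dToCycles T i j k)
  let g' (b : B) : CharacterModule (T.X i) :=
    AddMonoidHom.mk' (fun t => g t b) fun t t' => DFunLike.congr_fun (g.map_add t t') b
  refine ⟨{ toFun z := AddMonoidHom.mk' (fun b => s z.1 (g' b)) fun b b' => ?_
            map_add' z z' := CharacterModule.ext _ fun b =>
              DFunLike.congr_fun (s.map_add z.1 z'.1) (g' b)
            map_smul' r z := CharacterModule.ext _ fun b => ?_ }, fun z a => ?_⟩
  · rw [← map_add]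
    exact congrArg _ (CharacterModule.ext _ fun t => map_add (g t) b b')
  · refine (DFunLike.congr_fun (s.map_smul r z.1) (g' b)).trans ?_
    refine congrArg (s z.1) (CharacterModule.ext _ fun t => ?_)
    exact DFunLike.congr_fun (g.map_smul r t) b
  · obtain ⟨χ, hχ⟩ := exists_character_extension
      (LinearMap.ker (T.d j k).hom).subtype.toAddMonoidHom
      (AddMonoidHom.mk' (fun z => h z a) fun z z' => DFunLike.congr_fun (h.map_add z z') a)
      fun z hz => by
        have : z = 0 := Subtype.ext hz
        rw [this]
        exact map_zero _
    have hg' : g' (f a) = rightDualMap (T.d i j).hom χ := CharacterModule.ext _ fun t =>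
      (hg t a).trans (hχ (dToCycles T i j k t)).symm
    change s z.1 (g' (f a)) = h z a
    rw [hg', ← hs z.1 z.2]
    exact hχ z

variable {W F : ObjectProperty (ChainComplex (ModuleCat.{u} R) ℤ)}

theorem IsInjectiveCotorsionPair.exists_approximation_mem (h : IsInjectiveCotorsionPair W F)
    (hX : HasDGInjectiveDual X) : ∃ (T : ChainComplex (ModuleCat.{u} R) ℤ) (ι : X ⟶ T), W T ∧
      ∀ ⦃U V : ChainComplex (ModuleCat.{u} R) ℤ⦄ (p : U ⟶ V), IsTrivialFibration p →
        HasLiftingProperty ι p := by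
  obtain ⟨T, ι, hT, hι⟩ := exists_acyclic_approximation X
  refine ⟨T, ι, h.mem_of_acyclic_of_flat_cycles hT fun j k hk => ?_, hι⟩
  obtain ⟨s, hs⟩ := (hX.isBidualNullHomotopic T hT ι).exists_contraction hT hι (i := j + 1) rfl hk
  exact hasInjectiveDual_cycles_of_contraction
    (hasInjectiveDual_of_hasLiftingProperty hX.hasInjectiveDual hι) s hs

theorem acyclic_of_injective (I : ChainComplex (ModuleCat.{u} R) ℤ) [Injective I] : I.Acyclic := by
  have : HasLiftingProperty (sphereSumToDisc R) (0 : I ⟶ HomologicalComplex.zero) :=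
    Injective.hasLiftingProperty_of_isZero _ _ HomologicalComplex.isZero_zero
  exact acyclic_of_isTrivialFibration HomologicalComplex.isZero_zero
    (isTrivialFibration_of_hasLiftingProperty (p := (0 : I ⟶ HomologicalComplex.zero)))

theorem acyclic_right_of_shortExact {S : ShortComplex (ChainComplex (ModuleCat.{u} R) ℤ)}
    (hS : S.ShortExact) (h₁ : S.X₁.Acyclic) (h₂ : S.X₂.Acyclic) : S.X₃.Acyclic := by
  refine hS.acyclic_X₃ ⟨fun n => ?_⟩
  rw [quasiIsoAt_iff_exactAt]
  · exact h₂ n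
  · exact h₁ n

/-- A chain map from `X` to `I / Y` extends to an approximation of `X` by an object of `W`, since
`I / Y` is exact, and the extension lifts to `I`. -/
theorem IsInjectiveCotorsionPair.subsingleton_ext (h : IsInjectiveCotorsionPair W F)
    (hX : HasDGInjectiveDual X) {Y : ChainComplex (ModuleCat.{u} R) ℤ} (hY : F Y)
    (hY' : Y.Acyclic) : Subsingleton (Ext X Y 1) := by
  have hS := injectiveCosyzygy_shortExact Y
  obtain ⟨T, ι, hT, hι⟩ := h.exists_approximation_mem hX
  refine subsingleton_ext_of_exists_lift hS fun f => ?_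
  have hC : (injectiveCosyzygy Y).X₃.Acyclic :=
    acyclic_right_of_shortExact hS hY' (acyclic_of_injective _)
  have := hι _ (isTrivialFibration_of_isZero hC HomologicalComplex.isZero_zero
    (0 : _ ⟶ HomologicalComplex.zero))
  have sq : CommSq f ι (0 : _ ⟶ HomologicalComplex.zero) 0 := ⟨by simp⟩
  obtain ⟨g, hg⟩ := exists_lift_of_subsingleton_ext hS ((h.cotorsionPair.left_iff T).1 hT Y hY)
    sq.lift
  exact ⟨ι ≫ g, by rw [Category.assoc, hg, sq.fac_left]⟩

end DualComplexes

/-! ### Elements and characters of the tensor product of complexes -/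

section TensorElements

open HomologicalComplex

variable {R : Type u} [Ring R]

/-- A character of an abelian group as a morphism of `ℤ`-modules to a lift of `ℚ / ℤ`. -/
def characterHom {M : ModuleCat.{u} ℤ} (φ : CharacterModule M) :
    M ⟶ ModuleCat.of ℤ (ULift.{u} (AddCircle (1 : ℚ))) :=
  ModuleCat.ofHom
    { toFun m := ULift.up (φ m)
      map_add' m m' := congrArg ULift.up (map_add φ m m')
      map_smul' n m := congrArg ULift.up
        ((congrArg φ (int_smul_eq_zsmul M.isModule n m)).trans (map_zsmul φ n m)) }

variable {E : ChainComplex (ModuleCat.{u} Rᵐᵒᵖ) ℤ} {X : ChainComplex (ModuleCat.{u} R) ℤ}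

/-- The element `e ⊗ x` of the tensor product of two complexes. -/
noncomputable def complexTmul {p q n : ℤ} (h : p + q = n) (e : E.X p) (x : X.X q) :
    (tensorComplex E X).X n :=
  ιMapBifunctor E X (NCTensor.tensorBifunctor R) (ComplexShape.down ℤ) p q n h
    (Submodule.Quotient.mk (e ⊗ₜ[ℤ] x) : NCTensor.Tensor R (E.X p) (X.X q))

theorem complexTmul_add_left {p q n : ℤ} (h : p + q = n) (e e' : E.X p) (x : X.X q) :
    complexTmul h (e + e') x = complexTmul h e x + complexTmul h e' x := by
  rw [complexTmul, TensorProduct.add_tmul, Submodule.Quotient.mk_add]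
  exact map_add _ _ _

theorem complexTmul_add_right {p q n : ℤ} (h : p + q = n) (e : E.X p) (x x' : X.X q) :
    complexTmul h e (x + x') = complexTmul h e x + complexTmul h e x' := by
  rw [complexTmul, TensorProduct.tmul_add, Submodule.Quotient.mk_add]
  exact map_add _ _ _

theorem complexTmul_smul {p q n : ℤ} (h : p + q = n) (e : E.X p) (r : R) (x : X.X q) :
    complexTmul h (MulOpposite.op r • e) x = complexTmul h e (r • x) :=
  congrArg (ιMapBifunctor E X (NCTensor.tensorBifunctor R) (ComplexShape.down ℤ) p q n h)
    ((Submodule.Quotient.eq _).2 (Submodule.subset_span ⟨e, r, x, rfl⟩))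

theorem d_complexTmul {p q n p' q' n' : ℤ} (h : p + q = n) (h₁ : p' + q = n') (h₂ : p + q' = n')
    (hp : p' + 1 = p) (hq : q' + 1 = q) (e : E.X p) (x : X.X q) :
    (tensorComplex E X).d n n' (complexTmul h e x) =
      complexTmul h₁ (E.d p p' e) x + p.negOnePow • complexTmul h₂ e (X.d q q' x) := by
  let i₁ := ((NCTensor.tensorBifunctor R).map (E.d p p')).app (X.X q) ≫
    ιMapBifunctor E X (NCTensor.tensorBifunctor R) (ComplexShape.down ℤ) p' q n' h₁
  let i₂ := ((NCTensor.tensorBifunctor R).obj (E.X p)).map (X.d q q') ≫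
    ιMapBifunctor E X (NCTensor.tensorBifunctor R) (ComplexShape.down ℤ) p q' n' h₂
  have H : ιMapBifunctor E X (NCTensor.tensorBifunctor R) (ComplexShape.down ℤ) p q n h ≫
      (mapBifunctor E X (NCTensor.tensorBifunctor R) (ComplexShape.down ℤ)).d n n' =
        (1 : ℤˣ) • i₁ + p.negOnePow • i₂ := by
    rw [mapBifunctor.d_eq, Preadditive.comp_add, mapBifunctor.ι_D₁,
      mapBifunctor.ι_D₂,
      mapBifunctor.d₁_eq E X _ _ (show (ComplexShape.down ℤ).Rel p p' from hp) q n' h₁,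
      mapBifunctor.d₂_eq E X _ _ p (show (ComplexShape.down ℤ).Rel q q' from hq) n' h₂]
    rfl
  have H' := ConcreteCategory.congr_hom H
    (Submodule.Quotient.mk (e ⊗ₜ[ℤ] x) : NCTensor.Tensor R (E.X p) (X.X q))
  rw [one_smul] at H'
  rcases Int.units_eq_one_or p.negOnePow with hp | hp <;> rw [hp] at H' ⊢
  · rw [one_smul] at H' ⊢
    exact H'
  · rw [Units.neg_smul, one_smul] at H'
    have h₃ : (-1 : ℤˣ) • complexTmul h₂ e (X.d q q' x) = -complexTmul h₂ e (X.d q q' x) := by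
      rw [Units.smul_def, Units.val_neg, Units.val_one]
      exact neg_one_zsmul _
    rw [h₃]
    exact H'

theorem character_d_complexTmul {p q n p' q' n' : ℤ}
    (φ : CharacterModule ((tensorComplex E X).X n')) (h : p + q = n) (h₁ : p' + q = n')
    (h₂ : p + q' = n') (hp : p' + 1 = p) (hq : q' + 1 = q) (e : E.X p) (x : X.X q) :
    φ ((tensorComplex E X).d n n' (complexTmul h e x)) =
      φ (complexTmul h₁ (E.d p p' e) x) +
        (p.negOnePow : ℤ) • φ (complexTmul h₂ e (X.d q q' x)) := by
  rw [d_complexTmul h h₁ h₂ hp hq, map_add, Units.smul_def, map_zsmul]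

theorem complex_character_ext {n : ℤ} {φ ψ : CharacterModule ((tensorComplex E X).X n)}
    (h : ∀ (p q : ℤ) (hpq : p + q = n) (e : E.X p) (x : X.X q),
      φ (complexTmul hpq e x) = ψ (complexTmul hpq e x)) : φ = ψ := by
  have H : characterHom φ = characterHom ψ := by
    refine mapBifunctor.hom_ext fun p q hpq => ModuleCat.hom_ext ?_
    exact NCTensor.tensor_hom_ext fun e x => congrArg ULift.up (h p q hpq e x)
  exact CharacterModule.ext _ fun m => congrArg ULift.down (ConcreteCategory.congr_hom H m)

/-- Characters of a tensor product of complexes are families of homomorphisms to character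
modules. -/
theorem exists_complex_character {n : ℤ}
    (f : ∀ p q : ℤ, p + q = n → X.X q →ₗ[R] CharacterModule (E.X p)) :
    ∃ φ : CharacterModule ((tensorComplex E X).X n), ∀ (p q : ℤ) (h : p + q = n) (e : E.X p)
      (x : X.X q), φ (complexTmul h e x) = f p q h x e := by
  let f' (p q : ℤ) (h : p + q = n) : E.X p ⊗[ℤ] X.X q →ₗ[ℤ] ULift.{u} (AddCircle (1 : ℚ)) :=
    TensorProduct.lift (LinearMap.mk₂ ℤ (fun e x => ULift.up (f p q h x e))
      (fun e e' x => congrArg ULift.up (map_add (f p q h x) e e'))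
      (fun m e x => congrArg ULift.up (map_zsmul (f p q h x) m e))
      (fun e x x' => congrArg ULift.up (DFunLike.congr_fun ((f p q h).map_add x x') e))
      (fun m e x => congrArg ULift.up (DFunLike.congr_fun (map_zsmul (f p q h) m x) e)))
  have hf' (p q : ℤ) (h : p + q = n) :
      NCTensor.relations R (E.X p) (X.X q) ≤ LinearMap.ker (f' p q h) := by
    refine Submodule.span_le.2 ?_
    rintro _ ⟨e, r, x, rfl⟩
    have h₁ : f' p q h ((MulOpposite.op r • e) ⊗ₜ x) = f' p q h (e ⊗ₜ (r • x)) :=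
      congrArg ULift.up (DFunLike.congr_fun ((f p q h).map_smul r x) e).symm
    exact (map_sub (f' p q h) _ _).trans (sub_eq_zero.2 h₁)
  let g (p q : ℤ) (h : p + q = n) : ((NCTensor.tensorBifunctor R).obj (E.X p)).obj (X.X q) ⟶
      ModuleCat.of ℤ (ULift.{u} (AddCircle (1 : ℚ))) :=
    ModuleCat.ofHom (Submodule.liftQ _ (f' p q h) (hf' p q h))
  let G := mapBifunctorDesc (K₁ := E) (K₂ := X) (c := ComplexShape.down ℤ) (j := n) g
  refine ⟨AddMonoidHom.comp (AddEquiv.ulift (α := AddCircle (1 : ℚ))).toAddMonoidHom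
    G.hom.toAddMonoidHom, fun p q h e x => ?_⟩
  have H : ιMapBifunctor E X (NCTensor.tensorBifunctor R) (ComplexShape.down ℤ) p q n h ≫ G =
      g p q h := 
    ι_mapBifunctorDesc (K₁ := E) (K₂ := X) (c := ComplexShape.down ℤ) (j := n) g p q h
  exact congrArg (AddEquiv.ulift (α := AddCircle (1 : ℚ))) (ConcreteCategory.congr_hom H
    (Submodule.Quotient.mk (e ⊗ₜ[ℤ] x) : NCTensor.Tensor R (E.X p) (X.X q)))

end TensorElements

/-! ### DG-flat complexes -/

section DGFlat

variable {R : Type u} [Ring R]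

/-- The component of a character of a tensor product of complexes at a summand. -/
noncomputable def complexCharacterComponent {E : ChainComplex (ModuleCat.{u} Rᵐᵒᵖ) ℤ}
    {X : ChainComplex (ModuleCat.{u} R) ℤ} {n : ℤ} (φ : CharacterModule ((tensorComplex E X).X n))
    {p q : ℤ} (h : p + q = n) : X.X q →ₗ[R] CharacterModule (E.X p) where
  toFun x := AddMonoidHom.mk' (fun e => φ (complexTmul h e x)) fun e e' => by
    rw [complexTmul_add_left, map_add]
  map_add' x x' := CharacterModule.ext _ fun e =>
    (congrArg φ (complexTmul_add_right h e x x')).trans (map_add φ _ _)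
  map_smul' r x := CharacterModule.ext _ fun e => (congrArg φ (complexTmul_smul h e r x)).symm

variable {X T : ChainComplex (ModuleCat.{u} R) ℤ}

theorem XIsoOfEq_hom_f_d_apply (ι : X ⟶ T) {p p' q q' : ℤ} (h : q = p) (h' : q' = p')
    (x : X.X q) : T.d p p' ((T.XIsoOfEq h).hom (ι.f q x)) =
      (T.XIsoOfEq h').hom (ι.f q' (X.d q q' x)) := by
  subst h h'
  exact (hom_f_d_apply ι q q' x).symm

theorem XIsoOfEq_hom_d_apply {p p' q q' : ℤ} (h : q = p) (h' : q' = p')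
    (x : T.X q) : T.d p p' ((T.XIsoOfEq h).hom x) = (T.XIsoOfEq h').hom (T.d q q' x) := by
  subst h h'
  rfl

theorem XIsoOfEq_hom_hom_apply {p q : ℤ} (h : q = p) (h' : p = q) (x : T.X q) :
    (T.XIsoOfEq h').hom ((T.XIsoOfEq h).hom x) = x := by
  subst h
  rfl

/-- The elements of `X` are cycles, so their images are boundaries, and evaluation at them extends
along the transpose of the differential of `T`. -/
theorem HasDGInjectiveDual.of_d_eq_zero (hX : ∀ n, HasInjectiveDual R (X.X n))
    (hd : ∀ i j, X.d i j = 0) : HasDGInjectiveDual X where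
  hasInjectiveDual := hX
  isBidualNullHomotopic T hT ι := by
    have key (i j : ℤ) (hij : i + 1 = j) :
        ∃ g : X.X i →ₗ[R] CharacterModule (CharacterModule (T.X j)),
          ∀ x (χ : CharacterModule (T.X i)), g x (rightDualMap (T.d j i).hom χ) = χ (ι.f i x) := by
      refine (hX i).exists_extension (rightDualMap (T.d j i).hom)
        (bidualUnit R (T.X i) ∘ₗ (ι.f i).hom) fun χ hχ x => ?_
      obtain ⟨y, hy⟩ := (acyclic_iff_exists T).1 hT j i (i - 1) hij (by lia) (ι.f i x) (by
        rw [← hom_f_d_apply, hd]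
        exact map_zero _)
      change χ (ι.f i x) = 0
      rw [← hy]
      exact DFunLike.congr_fun hχ y
    choose s hs using key
    refine ⟨s, fun i j k hi hk x χ => ?_⟩
    rw [hs, hd j k]
    have h0 : s k j hk ((0 : X.X j ⟶ X.X k) x) = 0 := map_zero _
    rw [h0]
    exact (add_zero _).symm

/-- A chain map `ι : X ⟶ T` defines a functional on the tensor product of `X` with the character
complex of `T`. This tensor product is exact, so the functional factors through the differential,
and the components of the factorization are the homotopy, up to signs. -/
theorem IsDGFlat.hasDGInjectiveDual (hX : IsDGFlat X) : HasDGInjectiveDual X where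
  hasInjectiveDual n := (hX.1 n).hasInjectiveDual
  isBidualNullHomotopic T hT ι := by
    have hE := (acyclic_iff_exists _).1 (hX.2 _ (dualComplex_acyclic hT))
    -- These signs turn the sign rule of the tensor product into that of a chain map.
    let c (n : ℤ) : ℤˣ := (n * (n + 1) / 2).negOnePow
    have hc {j k : ℤ} (hk : k + 1 = j) : c j = j.negOnePow * c k := by
      subst hk
      rw [← Int.negOnePow_add]
      refine congrArg Int.negOnePow ?_
      rw [show (k + 1) * (k + 1 + 1) = k * (k + 1) + (k + 1) * 2 by ring,
        Int.add_mul_ediv_right _ _ two_ne_zero, add_comm]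
    let t (p q : ℤ) (h : p + q = 0) : X.X q →ₗ[R] T.X (-p) :=
      (T.XIsoOfEq (show q = -p by lia)).hom.hom ∘ₗ (ι.f q).hom
    obtain ⟨φ, hφ⟩ := exists_complex_character (E := dualComplex T) (X := X) (n := 0)
      fun p q h => (c q : ℤ) • (bidualUnit R (T.X (-p)) ∘ₗ t p q h)
    have hφ' (p q : ℤ) (h : p + q = 0) (e : CharacterModule (T.X (-p))) (x : X.X q) :
        φ (complexTmul (E := dualComplex T) h e x) = (c q : ℤ) • e (t p q h x) := hφ p q h e x
    have hφd (a) : φ ((tensorComplex (dualComplex T) X).d 1 0 a) = 0 := by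
      have h : AddMonoidHom.comp φ
          ((tensorComplex (dualComplex T) X).d 1 0).hom.toAddMonoidHom = 0 := by
        refine complex_character_ext fun p q hpq (e : CharacterModule (T.X (-p))) x => ?_
        have hq : q - 1 + 1 = q := by lia
        have hp : p - 1 + 1 = p := by lia
        have hpq' : p - 1 + q = 0 := by lia
        have hqp' : p + (q - 1) = 0 := by lia
        refine (character_d_complexTmul φ hpq hpq' hqp' hp hq e x).trans ((congrArg₂
          (fun a b => a + (p.negOnePow : ℤ) • b) (hφ' _ _ hpq' _ x) (hφ' _ _ hqp' e _)).trans ?_)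
        change (c q : ℤ) • e (T.d (-(p - 1)) (-p) (t (p - 1) q hpq' x)) +
          (p.negOnePow : ℤ) • (c (q - 1) : ℤ) • e (t p (q - 1) hqp' (X.d q (q - 1) x)) = 0
        have ht : T.d (-(p - 1)) (-p) (t (p - 1) q hpq' x) =
            t p (q - 1) hqp' (X.d q (q - 1) x) := XIsoOfEq_hom_f_d_apply ι _ _ x
        have hcq : c q = -(p.negOnePow * c (q - 1)) := by
          rw [hc hq, show q = -p + 1 by lia, Int.negOnePow_succ, Int.negOnePow_neg, neg_mul]
        rw [ht, hcq, smul_smul, ← add_smul, Units.val_neg, Units.val_mul, neg_add_cancel,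
          zero_smul]
      exact DFunLike.congr_fun h a
    obtain ⟨ψ, hψ⟩ := exists_character_extension
      ((tensorComplex (dualComplex T) X).d 0 (-1)).hom.toAddMonoidHom φ fun a ha => by
        obtain ⟨b, rfl⟩ := hE 1 0 (-1) rfl rfl a ha
        exact hφd b
    let s (i j : ℤ) (h : i + 1 = j) : X.X i →ₗ[R] CharacterModule (CharacterModule (T.X j)) :=
      (c i : ℤ) • (leftDualMap (rightDualMap (T.XIsoOfEq (neg_neg j)).hom.hom) ∘ₗ
        complexCharacterComponent (E := dualComplex T) (p := -j) ψ (by lia))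
    refine ⟨s, fun i j k hi hk x χ => ?_⟩
    let e := rightDualMap (T.XIsoOfEq (neg_neg j)).hom.hom χ
    have hd : rightDualMap (T.d (- -i) (- -j)).hom e =
        rightDualMap (T.XIsoOfEq (neg_neg i)).hom.hom (rightDualMap (T.d i j).hom χ) :=
      CharacterModule.ext _ fun y => congrArg χ
        (XIsoOfEq_hom_d_apply (neg_neg i) (neg_neg j) y).symm
    have hi' : -i + j = -1 := by lia
    have hk' : -j + k = -1 := by lia
    have hj' : -j + j = 0 := by lia
    let a : AddCircle (1 : ℚ) := complexCharacterComponent (E := dualComplex T) ψ hi' x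
      (rightDualMap (T.XIsoOfEq (neg_neg i)).hom.hom (rightDualMap (T.d i j).hom χ))
    let b : AddCircle (1 : ℚ) := complexCharacterComponent (E := dualComplex T) ψ hk' (X.d j k x) e
    have h₀ : e (t (-j) j hj' x) = χ (ι.f j x) :=
      congrArg χ (XIsoOfEq_hom_hom_apply _ _ _)
    have h₁ : (c j : ℤ) • χ (ι.f j x) = a + (j.negOnePow : ℤ) • b := by
      rw [← h₀, ← Int.negOnePow_neg]
      refine (hφ' (-j) j hj' e x).symm.trans ((hψ _).symm.trans
        ((character_d_complexTmul ψ hj' hi' hk' (by lia) hk e x).trans ?_))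
      exact congrArg (fun y => complexCharacterComponent (E := dualComplex T) ψ hi' x y +
        ((-j).negOnePow : ℤ) • b) hd
    change χ (ι.f j x) = (c j : ℤ) • a + (c k : ℤ) • b
    have h₂ : (c k : ℤ) = c j * j.negOnePow := by
      rw [hc hk, ← Units.val_mul, mul_right_comm, Int.units_mul_self, one_mul]
    rw [h₂, mul_smul, ← smul_add, ← h₁, smul_smul, ← Units.val_mul, Int.units_mul_self,
      Units.val_one, one_smul]

end DGFlat

/-! ### Cotorsion modules -/

section Cotorsion

variable {R : Type u} [Ring R]

theorem subsingleton_ext_of_exists_extension {S : ShortComplex (ModuleCat.{u} R)}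
    (hS : S.ShortExact) [Projective S.X₂] {Y : ModuleCat.{u} R}
    (hY : ∀ h : S.X₁ ⟶ Y, ∃ g : S.X₂ ⟶ Y, S.f ≫ g = h) : Subsingleton (Ext S.X₃ Y 1) := by
  refine subsingleton_of_forall_eq 0 fun x => ?_
  obtain ⟨y, rfl⟩ := Ext.contravariant_sequence_exact₃ hS Y x
    (Ext.eq_zero_of_projective _) (add_zero 1)
  obtain ⟨h, rfl⟩ := Ext.homEquiv₀.symm.surjective y
  obtain ⟨g, rfl⟩ := hY h
  have : (Ext.homEquiv₀.symm (S.f ≫ g) : Ext S.X₁ Y 0) =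
      (Ext.mk₀ S.f).comp (Ext.mk₀ g) (zero_add 0) := by
    simp [Ext.homEquiv₀]
  rw [this, hS.extClass_comp_assoc]

theorem IsFlatModule.hasDGInjectiveDual_single {M : ModuleCat.{u} R} (hM : IsFlatModule M) (n : ℤ) :
    HasDGInjectiveDual ((HomologicalComplex.single _ (ComplexShape.down ℤ) n).obj M) := by
  refine .of_d_eq_zero (fun k => ?_) fun _ _ => rfl
  by_cases hk : k = n
  · exact hM.hasInjectiveDual.of_linearEquiv
      (HomologicalComplex.singleObjXIsoOfEq (ComplexShape.down ℤ) n M k hk).symm.toLinearEquiv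
  · have := ModuleCat.subsingleton_of_isZero
      (HomologicalComplex.isZero_single_obj_X (ComplexShape.down ℤ) n M k hk)
    exact .of_subsingleton

/-- Morphisms from a module to the cycles of `Y` are chain maps to `Y` from the complex with this
module in a single degree. -/
theorem subsingleton_ext_cycles (Y : ChainComplex (ModuleCat.{u} R) ℤ) (n : ℤ)
    (M : ModuleCat.{u} R)
    (h : Subsingleton (Ext ((HomologicalComplex.single _ (ComplexShape.down ℤ) n).obj M) Y 1)) :
    Subsingleton (Ext M (Y.cycles n) 1) := by
  let S := ShortComplex.mk (kernel.ι (Projective.π M)) (Projective.π M) (kernel.condition _)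
  have hS : S.ShortExact :=
    { exact := ShortComplex.exact_kernel _
      mono_f := inferInstanceAs (Mono (kernel.ι _))
      epi_g := inferInstanceAs (Epi (Projective.π M)) }
  have : Projective S.X₂ := inferInstanceAs (Projective (Projective.over M))
  refine subsingleton_ext_of_exists_extension hS fun f => ?_
  let L := HomologicalComplex.single (ModuleCat.{u} R) (ComplexShape.down ℤ) n
  let f' : L.obj S.X₁ ⟶ Y := HomologicalComplex.mkHomFromSingle (f ≫ Y.iCycles n) fun k _ => by simp
  obtain ⟨g, hg⟩ : ∃ g : L.obj S.X₂ ⟶ Y, L.map S.f ≫ g = f' :=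
    exists_extension_of_subsingleton_ext (hS.map_of_exact L) h f'
  have hgn := HomologicalComplex.congr_hom hg n
  rw [HomologicalComplex.mkHomFromSingle_f, HomologicalComplex.comp_f,
    HomologicalComplex.single_map_f_self, Category.assoc, Category.assoc, Iso.cancel_iso_hom_left]
    at hgn
  refine ⟨Y.liftCycles ((HomologicalComplex.singleObjXSelf (ComplexShape.down ℤ) n S.X₂).inv ≫
    g.f n) (n - 1) (by simp) ?_, ?_⟩
  · rw [Category.assoc, g.comm, HomologicalComplex.single_obj_d, zero_comp, comp_zero]
  · rw [← cancel_mono (Y.iCycles n), Category.assoc, HomologicalComplex.liftCycles_i, hgn]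

theorem shortExact_cycles {Y : ChainComplex (ModuleCat.{u} R) ℤ} (hY : Y.Acyclic) (n : ℤ) :
    ∃ w, (ShortComplex.mk (Y.iCycles n) (Y.toCycles n (n - 1)) w).ShortExact := by
  have w : Y.iCycles n ≫ Y.toCycles n (n - 1) = 0 := by
    rw [← cancel_mono (Y.iCycles (n - 1))]
    simp
  refine ⟨w, { exact := ?_, mono_f := inferInstanceAs (Mono (Y.iCycles n)), epi_g := ?_ }⟩
  · exact ShortComplex.exact_of_f_is_kernel _
      (isKernelOfComp _ _ (Y.cyclesIsKernel n (n - 1) (by simp)) w (Y.toCycles_i n (n - 1)))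
  · have h := (Y.exactAt_iff' n (n - 1) (n - 1 - 1) (by simp) (by simp)).1 (hY (n - 1))
    have he := Y.toCycles_cyclesIsoSc'_hom n (n - 1) (n - 1 - 1) (by simp) (by simp)
    change Epi (Y.toCycles n (n - 1))
    rw [(Iso.eq_comp_inv _).2 he]
    exact epi_comp' h.epi_toCycles inferInstance

variable {W F : ObjectProperty (ChainComplex (ModuleCat.{u} R) ℤ)}

theorem IsInjectiveCotorsionPair.isCotorsionModule_cycles (h : IsInjectiveCotorsionPair W F)
    {Y : ChainComplex (ModuleCat.{u} R) ℤ} (hY : F Y) (hY' : Y.Acyclic) (n : ℤ) :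
    IsCotorsionModule (Y.cycles n) := fun M hM =>
  subsingleton_ext_cycles Y n M (h.subsingleton_ext (hM.hasDGInjectiveDual_single n) hY hY')

end Cotorsion

theorem corollary3p4 (R : Type u) [Ring R]
    (W F : ObjectProperty (ChainComplex (ModuleCat.{u} R) ℤ))
    (hWF : IsInjectiveCotorsionPair W F) :
    (∀ Y : ChainComplex (ModuleCat.{u} R) ℤ, F Y → Y.Acyclic →
      (∀ n : ℤ, IsCotorsionModule (Y.cycles n)) ∧ ∀ n : ℤ, IsCotorsionModule (Y.X n)) ∧
    ((∀ Y : ChainComplex (ModuleCat.{u} R) ℤ, F Y → Y.Acyclic) →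
      ∀ X : ChainComplex (ModuleCat.{u} R) ℤ, IsDGFlat X → W X) := by
  refine ⟨fun Y hY hY' => ?_, fun hF X hX => ?_⟩
  · have hZ (n : ℤ) : IsCotorsionModule (Y.cycles n) :=
      hWF.isCotorsionModule_cycles hY hY' n
    refine ⟨hZ, fun n M hM => ?_⟩
    obtain ⟨_, hS⟩ := shortExact_cycles hY' n
    exact subsingleton_ext_of_shortExact_right hS (hZ n M hM) (hZ (n - 1) M hM)
  · exact (hWF.cotorsionPair.left_iff X).2 fun Y hY =>
      hWF.subsingleton_ext hX.hasDGInjectiveDual hY (hF Y hY)
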